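/- **The model.** For $l\ge 0$ the streets of level $l$ are the $2^l$ vertical segments $\{b2^{-(l+1)}\}\times[0,1]$ and the $2^l$ horizontal segments $[0,1]\times\{b2^{-(l+1)}\}$, $b=1,3,\dots,2^{l+1}-1$; the two streets of level $0$ form the central cross. Let $0<p<1$, $q=1-p$, $0<p_r<1$, and $$d_F=\frac{\log(4/q)}{\log 2},\qquad d_r=2\,\frac{\log(2/(1-p_r))}{\log 2},\qquad d_F>3,\quad d_r<d_F-1 .$$ The hyperfractal with $n$ nodes consists of $n$ independent mobile nodes, each with one-dimensional density $(p/2)(q/2)^l$ on the streets of level $l$, and, independently of them, of fixed relays: a crossing of a street of level $h$ with a perpendicular street of level $v$ holds a relay iff a Poisson variable with mean $n\,p_r^2\big((1-p_r)/2\big)^{h+v}$ is at least $1$, independently for all crossings. **Communication.** Two nodes (mobile nodes or relays) can be joined by a hop along a street if both stand on it and no mobile node stands on it strictly between them. A transmission along a street that contains $m$ mobile nodes has power $P_{\max}/\max(1,m)^{\delta}$, where $P_{\max}>0$ and $\delta\ge 2$. A path is a sequence $\mathcal T$ of nodes in which each node is joined to the next one by a hop; each node transmits with the power of the street of its next hop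 (the last one with the power of a street on which it stands). The accumulated energy of $\mathcal T$ is the sum of the powers of all its nodes, and its length is the number $|\mathcal T|$ of its nodes, i.e. the number of hops plus one. Let $G_1(n,E)$ be the set of mobile nodes that are connected to some node on the central cross by a path of accumulated energy at most $E$ which contains at most one relay. **Theorem.** Let $v_E>6$ and $E_n=v_EP_{\max}$, and put $$\gamma=1-\frac{2}{d_r(1+1/d_F)} .$$ 1. There is a constant $C>0$, independent of $n$, such that with probability tending to $1$ as $n\to\infty$ the following holds for all pairs of nodes of $G_1(n,E_n)$ at once: a shortest path among the paths between the two nodes with accumulated energy at most $E_n$ exists and has length (hence number of hops) at most $Cn^{\gamma}$. 2. For nodes on the two different streets of the central cross the order $n^\gamma$ is achieved, in probability, by paths through five fixed relays: for every $\varepsilon>0$ there is $C>0$ such that for all large $n$ and any two different mobile nodes $i,j$, the probability that $i$ and $j$ stand on two different streets of the central cross and are not joined by a path with pairwise different nodes, accumulated energy at most $E_n$, exactly five relays and length at most $Cn^{\gamma}$ is at most $\varepsilon$. -/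

import Mathlib

open MeasureTheory ProbabilityTheory Filter Topology
open scoped ENNReal NNReal

noncomputable section

namespace Hyperfractal

/-! ### The grid of streets in the unit square -/

/-- The `2 ^ l` lines of level `l` in one direction, for all levels `l = 0, 1, 2, …`. -/
abbrev Line : Type := Σ l : ℕ, Fin (2 ^ l)

/-- The constant coordinate `b / 2 ^ (l + 1)` of a line of level `l`, where
`b = 2 k + 1` runs through the odd numbers `1, 3, …, 2 ^ (l + 1) - 1`. -/
def Line.coord (L : Line) : ℝ := (2 * (L.2 : ℕ) + 1) / 2 ^ (L.1 + 1)

/-- A street is a horizontal or a vertical unit segment. -/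
inductive Street : Type
  | horizontal (L : Line)
  | vertical (L : Line)

/-- The level of a street. -/
def Street.level : Street → ℕ
  | .horizontal L => L.1
  | .vertical L => L.1

/-- The point of a street at abscissa `t` along the street. -/
def Street.point : Street → ℝ → ℝ × ℝ
  | .horizontal L, t => (t, L.coord)
  | .vertical L, t => (L.coord, t)

/-- The abscissa, along the street, of a point of that street. -/
def Street.along : Street → ℝ × ℝ → ℝ
  | .horizontal _, z => z.1
  | .vertical _, z => z.2

/-- The street as a subset of the plane. -/
def Street.carrier (s : Street) : Set (ℝ × ℝ) := s.point '' Set.Icc 0 1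

/-- The union of all streets of level `l`. -/
def streetsOfLevel (l : ℕ) : Set (ℝ × ℝ) := ⋃ s ∈ {s : Street | s.level = l}, s.carrier

/-- The central cross. -/
def centralCross : Set (ℝ × ℝ) := streetsOfLevel 0

/-- A crossing of a vertical street (`col`) and a horizontal street (`row`). -/
structure Crossing : Type where
  /-- the vertical street -/
  col : Line
  /-- the horizontal street -/
  row : Line

/-- The location of a crossing. -/
def Crossing.pos (c : Crossing) : ℝ × ℝ := (c.col.coord, c.row.coord)

/-! ### The random mobile nodes and the random relays -/

/-- The law of one mobile node: one-dimensional density `(p / 2) (q / 2) ^ l` with `q = 1 - p` on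
every street of level `l`. -/
def nodeLaw (p : ℝ) : Measure (ℝ × ℝ) :=
  Measure.sum fun s : Street =>
    ENNReal.ofReal (p / 2 * ((1 - p) / 2) ^ s.level) •
      (volume.restrict (Set.Icc (0 : ℝ) 1)).map s.point

/-- The intensity at a crossing of the auxiliary Poisson process with total intensity `ρ`. -/
def relayIntensity (pr ρ : ℝ) (c : Crossing) : ℝ :=
  ρ * pr ^ 2 * ((1 - pr) / 2) ^ (c.row.1 + c.col.1)

/-- A configuration: the positions of the `n` mobile nodes and, at each crossing, the number of
points of the auxiliary process. -/
abbrev Config (n : ℕ) : Type := (Fin n → ℝ × ℝ) × (Crossing → ℕ)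

/-- The hyperfractal with `n` nodes: `n` independent mobile nodes, and, independently of them,
independent Poisson counts at the crossings, with total intensity `n`. -/
def hyperfractalLaw (p pr : ℝ) (n : ℕ) : Measure (Config n) :=
  (Measure.pi fun _ : Fin n => nodeLaw p).prod
    (Measure.infinitePi fun c : Crossing => poissonMeasure (relayIntensity pr n c).toNNReal)

/-- The fractal dimension `d_F` of the mobile nodes. -/
def nodeDim (p : ℝ) : ℝ := Real.log (4 / (1 - p)) / Real.log 2

/-- The fractal dimension `d_r` of the relays. -/
def relayDim (pr : ℝ) : ℝ := 2 * (Real.log (2 / (1 - pr)) / Real.log 2)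

/-! ### Communication -/

/-- Mobile nodes (`Sum.inl`) and possible fixed relays (`Sum.inr`). -/
abbrev Node (n : ℕ) : Type := Fin n ⊕ Crossing

variable {n : ℕ}

/-- The position of a node. -/
def pos (ω : Config n) : Node n → ℝ × ℝ
  | .inl i => ω.1 i
  | .inr c => c.pos

/-- A relay is installed at a crossing iff the auxiliary process has at least one point there. -/
def Present (ω : Config n) : Node n → Prop
  | .inl _ => True
  | .inr c => 1 ≤ ω.2 c

/-- The number of mobile nodes on a street. -/
def population (ω : Config n) (s : Street) : ℕ := Set.ncard {i : Fin n | ω.1 i ∈ s.carrier}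

/-- The nominal power `Pmax / m ^ δ` of a transmission on a street with `m` mobile nodes. On a
street without mobile nodes a relay has to use the power `Pmax`, which reaches from one end of the
street to the other. -/
def power (Pmax δ : ℝ) (ω : Config n) (s : Street) : ℝ :=
  Pmax / (max 1 (population ω s) : ℝ) ^ δ

/-- Nearest neighbour transmission along the street `s`: both ends stand on `s`, and there is no
mobile node on `s` strictly between them. -/
def Hop (ω : Config n) (s : Street) (t t' : Node n) : Prop :=
  t ≠ t' ∧ pos ω t ∈ s.carrier ∧ pos ω t' ∈ s.carrier ∧
    ∀ i : Fin n, ω.1 i ∈ s.carrier →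
      s.along (ω.1 i) ∉ Set.uIoo (s.along (pos ω t)) (s.along (pos ω t'))

/-- A routing path as a list of nodes, each paired with the street (the radio interface) on which
it transmits. Every node of the path is present and stands on the street of its interface, and it
reaches the next node of the path by a hop along that street. (A mobile node has, almost surely,
only one interface; a relay has two.) -/
def IsRoute (ω : Config n) (T : List (Node n × Street)) : Prop :=
  (∀ e ∈ T, Present ω e.1 ∧ pos ω e.1 ∈ e.2.carrier) ∧
    T.IsChain (fun e e' => Hop ω e.2 e.1 e'.1)

/-- The accumulated energy of a path: the sum of the powers of all its nodes. -/
def energy (Pmax δ : ℝ) (ω : Config n) (T : List (Node n × Street)) : ℝ :=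
  (T.map fun e => power Pmax δ ω e.2).sum

/-- The number of fixed relays on a path. -/
def relayCount (T : List (Node n × Street)) : ℕ := T.countP fun e => e.1.isRight

/-- `T` is a routing path from the mobile node `i` to the mobile node `j` with accumulated energy
at most `E`. -/
def IsRouteBetween (Pmax δ : ℝ) (ω : Config n) (E : ℝ) (i j : Fin n)
    (T : List (Node n × Street)) : Prop :=
  IsRoute ω T ∧ T.head?.map Prod.fst = some (Sum.inl i) ∧
    T.getLast?.map Prod.fst = some (Sum.inl j) ∧ energy Pmax δ ω T ≤ E

/-- The set `G_k(n, E)` of the mobile nodes that are connected to the central cross by a path of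
accumulated energy at most `E` through at most `k` fixed relays. -/
def giant (Pmax δ : ℝ) (ω : Config n) (k : ℕ) (E : ℝ) : Set (Fin n) :=
  {i | ∃ T : List (Node n × Street), IsRoute ω T ∧
    T.head?.map Prod.fst = some (Sum.inl i) ∧
    (∃ t, T.getLast?.map Prod.fst = some t ∧ pos ω t ∈ centralCross) ∧
    energy Pmax δ ω T ≤ E ∧ relayCount T ≤ k}

/-- The length `|T|`, in number of nodes (the number of hops plus one), of a shortest path from `i`
to `j` among those with accumulated energy at most `E`; it is `∞` if there is no such path. -/
def shortestLength (Pmax δ : ℝ) (ω : Config n) (E : ℝ) (i j : Fin n) : ℝ≥0∞ :=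
  ⨅ T ∈ {T : List (Node n × Street) | IsRouteBetween Pmax δ ω E i j T}, (T.length : ℝ≥0∞)

/-- The exponent `1 - 2 / (d_r (1 + 1 / d_F))`. -/
def hopExponent (p pr : ℝ) : ℝ := 1 - 2 / (relayDim pr * (1 + 1 / nodeDim p))

end Hyperfractal

end

/-! Put x = log₂ n, A = d_F − 1, D = d_r / 2 and β = 1 − γ. A street of level l then carries on
average of the order of n·2^(−Al) mobile nodes, and the Poisson mean at a crossing of levels l and
l' is n·p_r²·2^(−D(l+l')). Two levels govern the routes: h ≈ βx/A, where the population of a street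
has dropped to the order n^γ, and the higher level v ≈ βx. A street of level l < h is cut into about
2^(βx − Al) equal cells, each holding at most t ≈ 4n^γ mobile nodes; streets of level at least h are
a single cell.

Each cell of a street of level at most h contains a relay towards level v, each half of a street of
level v contains one towards level h, and all crossings of two streets of level h hold relays,
because the expected numbers are positive powers of n (`exists_exponent`). So from a street of level
at most h one reaches a nearby relay, follows a street of level v and arrives at level h, where any
two streets are joined by relays. A node of G_1 on a higher level first uses the single relay that
ties its street to the central cross. The number of legs is bounded and each passes at most t mobile
nodes, whence the order n^γ.

The energy is bounded because δ ≥ 2: crossing a street with m ≥ 1 mobile nodes takes at most m + 1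
transmissions of power at most Pmax/m². This costs at most 2·Pmax in general, Pmax/5 if m ≥ 10, and
Pmax if at most m transmissions are needed. The totals stay below 6·Pmax.

All this is deterministic on `IsTypical` configurations (`exists_route_of_mem_giant`,
`exists_route_of_cross`). The probabilistic half, `hyperfractalLaw_not_isTypical_le` with
`exists_typical_levels`, shows by union bounds that the exceptional probability tends to 0. -/

noncomputable section

namespace Hyperfractal

/-! ### Geometry of the streets -/

/-- The street with direction `d` (`true` for horizontal) carried by the line `L`. -/
def Street.ofDir : Bool → Line → Street
  | true, L => .horizontal L
  | false, L => .vertical L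

/-- The crossing of the street of direction `d` on `L` with the perpendicular street on `L'`. -/
def crossingOf : Bool → Line → Line → Crossing
  | true, L, L' => ⟨L', L⟩
  | false, L, L' => ⟨L, L'⟩

theorem crossingOf_not (d : Bool) (L L' : Line) : crossingOf (!d) L L' = crossingOf d L' L := by
  cases d <;> rfl

@[simp] theorem Street.level_ofDir (d : Bool) (L : Line) : (Street.ofDir d L).level = L.1 := by
  cases d <;> rfl

theorem Street.exists_ofDir (s : Street) : ∃ d L, s = Street.ofDir d L := by
  cases s with
  | horizontal L => exact ⟨true, L, rfl⟩
  | vertical L => exact ⟨false, L, rfl⟩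

theorem crossingOf_injective {d : Bool} {L₁ L₂ L₁' L₂' : Line}
    (h : crossingOf d L₁ L₂ = crossingOf d L₁' L₂') : L₁ = L₁' ∧ L₂ = L₂' := by
  cases d <;> simp_all [crossingOf]

theorem Street.mem_carrier {s : Street} {z : ℝ × ℝ} :
    z ∈ s.carrier ↔ s.point (s.along z) = z ∧ s.along z ∈ Set.Icc 0 1 := by
  constructor
  · rintro ⟨t, ht, rfl⟩
    cases s <;> simpa [Street.point, Street.along] using ht
  · rintro ⟨h, h'⟩
    exact ⟨_, h', h⟩

theorem Line.coord_pos (L : Line) : 0 < L.coord := by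
  unfold Line.coord; positivity

theorem Line.coord_lt_one (L : Line) : L.coord < 1 := by
  unfold Line.coord
  rw [div_lt_one (by positivity)]
  have h : (L.2 : ℕ) + 1 ≤ 2 ^ L.1 := L.2.2
  have h' : ((L.2 : ℕ) : ℝ) + 1 ≤ 2 ^ L.1 := by exact_mod_cast h
  rw [pow_succ]; linarith

/-- The level is read off from the 2-adic valuation of the denominator, since the numerator is odd;
the index then follows. -/
theorem Line.coord_injective {L L' : Line} (h : L.coord = L'.coord) : L = L' := by
  obtain ⟨l, m⟩ := L
  obtain ⟨l', m'⟩ := L'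
  simp only [Line.coord] at h
  rw [div_eq_div_iff (by positivity) (by positivity)] at h
  have h1 : (2 * (m : ℕ) + 1) * 2 ^ (l' + 1) = (2 * (m' : ℕ) + 1) * 2 ^ (l + 1) := by
    exact_mod_cast h
  have key : ∀ {a b : ℕ} {l l' : ℕ}, (2 * a + 1) * 2 ^ (l' + 1) = (2 * b + 1) * 2 ^ (l + 1) →
      l' ≤ l := by
    intro a b l l' h
    have hd : 2 ^ (l' + 1) ∣ (2 * b + 1) * 2 ^ (l + 1) := ⟨2 * a + 1, by rw [← h]; ring⟩
    have hc : Nat.Coprime (2 ^ (l' + 1)) (2 * b + 1) := by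
      apply Nat.Coprime.pow_left
      simp
    have := (Nat.pow_dvd_pow_iff_le_right (by norm_num : 1 < 2)).1 (hc.dvd_of_dvd_mul_left hd)
    omega
  have hl : l = l' := le_antisymm (key h1.symm) (key h1)
  subst hl
  have := Nat.eq_of_mul_eq_mul_right (by positivity) h1
  have hm : m = m' := Fin.ext (by omega)
  rw [hm]

theorem Line.eq_of_level_zero {L L' : Line} (h : L.1 = 0) (h' : L'.1 = 0) : L = L' := by
  obtain ⟨l, m⟩ := L
  obtain ⟨l', m'⟩ := L'
  simp only at h h'
  subst h h'
  have h := m.2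
  have h' := m'.2
  rw [show m = m' from Fin.ext (by simp only [pow_zero] at h h'; omega)]

theorem Line.coord_of_level_zero {L : Line} (h : L.1 = 0) : L.coord = 1 / 2 := by
  rw [Line.eq_of_level_zero (L' := ⟨0, ⟨0, by norm_num⟩⟩) h rfl]
  norm_num [Line.coord]

theorem crossingOf_pos_mem (d : Bool) (L L' : Line) :
    (crossingOf d L L').pos ∈ (Street.ofDir d L).carrier := by
  rw [Street.mem_carrier]
  cases d <;> simp [crossingOf, Crossing.pos, Street.ofDir, Street.point, Street.along,
    (Line.coord_pos _).le, (Line.coord_lt_one _).le]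

theorem crossingOf_pos_mem' (d : Bool) (L L' : Line) :
    (crossingOf d L L').pos ∈ (Street.ofDir (!d) L').carrier := by
  rw [← crossingOf_not]
  exact crossingOf_pos_mem _ _ _

theorem along_crossingOf (d : Bool) (L L' : Line) :
    (Street.ofDir d L).along (crossingOf d L L').pos = L'.coord := by
  cases d <;> rfl

theorem along_crossingOf' (d : Bool) (L L' : Line) :
    (Street.ofDir (!d) L').along (crossingOf d L L').pos = L.coord := by
  cases d <;> rfl

theorem eq_crossingOf_of_mem {c : Crossing} {d : Bool} {L : Line}
    (h : c.pos ∈ (Street.ofDir d L).carrier) : ∃ L', c = crossingOf d L L' := by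
  rw [Street.mem_carrier] at h
  obtain ⟨col, row⟩ := c
  cases d
  · refine ⟨row, ?_⟩
    have := Line.coord_injective (congrArg Prod.fst h.1)
    simp_all [crossingOf]
  · refine ⟨col, ?_⟩
    have := Line.coord_injective (congrArg Prod.snd h.1)
    simp_all [crossingOf]

theorem mem_centralCross {z : ℝ × ℝ} :
    z ∈ centralCross ↔ ∃ s : Street, s.level = 0 ∧ z ∈ s.carrier := by
  simp [centralCross, streetsOfLevel]

theorem Street.carrier_inter_parallel {d : Bool} {L L' : Line} {z : ℝ × ℝ}
    (h : z ∈ (Street.ofDir d L).carrier) (h' : z ∈ (Street.ofDir d L').carrier) : L = L' := by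
  rw [Street.mem_carrier] at h h'
  apply Line.coord_injective
  cases d
  · exact (congrArg Prod.fst h.1).trans (congrArg Prod.fst h'.1).symm
  · exact (congrArg Prod.snd h.1).trans (congrArg Prod.snd h'.1).symm

theorem Street.eq_pos_of_mem_of_mem {s s' : Street} {z : ℝ × ℝ} (hs : s ≠ s')
    (h : z ∈ s.carrier) (h' : z ∈ s'.carrier) : ∃ c : Crossing, z = c.pos := by
  obtain ⟨d, L, rfl⟩ := s.exists_ofDir
  obtain ⟨d', L', rfl⟩ := s'.exists_ofDir
  by_cases hd : d = d'
  · subst hd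
    exact absurd (by rw [Street.carrier_inter_parallel h h']) hs
  · refine ⟨crossingOf d L L', ?_⟩
    rw [Street.mem_carrier] at h h'
    cases d <;> cases d' <;> simp at hd
    · exact Prod.ext (congrArg Prod.fst h.1).symm (congrArg Prod.snd h'.1).symm
    · exact Prod.ext (congrArg Prod.fst h'.1).symm (congrArg Prod.snd h.1).symm

/-! ### Dyadic cells -/

/-- The closed dyadic interval `[j / 2 ^ k, (j + 1) / 2 ^ k]`. -/
def dyadicCell (k j : ℕ) : Set ℝ := Set.Icc (j / 2 ^ k) ((j + 1) / 2 ^ k)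

theorem exists_mem_dyadicCell (k : ℕ) {x : ℝ} (hx : x ∈ Set.Icc (0 : ℝ) 1) :
    ∃ j < 2 ^ k, x ∈ dyadicCell k j := by
  have h2 : (0 : ℝ) < 2 ^ k := by positivity
  rcases hx.2.lt_or_eq with h | h
  · refine ⟨⌊x * 2 ^ k⌋₊, ?_, ?_, ?_⟩
    · rw [Nat.floor_lt (by have := hx.1; positivity)]
      push_cast
      nlinarith
    · rw [div_le_iff₀ h2]
      exact Nat.floor_le (by have := hx.1; positivity)
    · rw [le_div_iff₀ h2]
      exact (Nat.lt_floor_add_one _).le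
  -- The cells are closed, so the endpoint 1 belongs to the last one.
  · refine ⟨2 ^ k - 1, by have := Nat.two_pow_pos k; omega, ?_⟩
    have : ((2 ^ k - 1 : ℕ) : ℝ) = 2 ^ k - 1 := by
      rw [Nat.cast_sub Nat.one_le_two_pow]; simp
    simp only [dyadicCell, this, h]
    refine ⟨?_, ?_⟩
    · rw [div_le_one h2]; linarith
    · rw [le_div_iff₀ h2]; linarith

theorem dyadicCell_zero_zero : dyadicCell 0 0 = Set.Icc 0 1 := by
  simp [dyadicCell]

theorem dyadicCell_subset {k j : ℕ} (hj : j < 2 ^ k) : dyadicCell k j ⊆ Set.Icc 0 1 := by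
  apply Set.Icc_subset_Icc
  · positivity
  · rw [div_le_one (by positivity)]
    exact_mod_cast hj

/-- The line of level `l` with index `j * 2 ^ (l - k) + r`. -/
theorem coord_mem_dyadicCell {k l j r : ℕ} (hk : k ≤ l) (hr : r < 2 ^ (l - k))
    (hm : j * 2 ^ (l - k) + r < 2 ^ l) :
    Line.coord ⟨l, ⟨j * 2 ^ (l - k) + r, hm⟩⟩ ∈ dyadicCell k j := by
  obtain ⟨e, rfl⟩ := Nat.exists_eq_add_of_le hk
  have hr' : (r : ℝ) + 1 ≤ 2 ^ e := by
    have : r + 1 ≤ 2 ^ e := by simpa using hr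
    exact_mod_cast this
  simp only [Line.coord, dyadicCell, Nat.add_sub_cancel_left, Nat.cast_add, Nat.cast_mul,
    Nat.cast_pow, Nat.cast_ofNat, Set.mem_Icc]
  have h2 : (0 : ℝ) < 2 ^ k := by positivity
  have he : (0 : ℝ) < 2 ^ e := by positivity
  have h3 : (2 : ℝ) ^ (k + e + 1) = 2 ^ k * 2 ^ e * 2 := by ring
  rw [h3]
  constructor
  · rw [div_le_div_iff₀ h2 (by positivity)]
    have : (0 : ℝ) ≤ r := Nat.cast_nonneg r
    have : 0 ≤ (2 * r + 1) * (2 : ℝ) ^ k := by positivity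
    linarith
  · rw [div_le_div_iff₀ (by positivity) h2]
    have : 0 ≤ (2 * 2 ^ e - 2 * r - 1) * (2 : ℝ) ^ k := mul_nonneg (by linarith) h2.le
    linarith

/-! ### Walks along a street -/

/-- The mobile nodes on the street `s` strictly between the nodes `t` and `t'`. -/
def between {n : ℕ} (ω : Config n) (s : Street) (t t' : Node n) : Set (Fin n) :=
  {i | ω.1 i ∈ s.carrier ∧ s.along (ω.1 i) ∈ Set.uIoo (s.along (pos ω t)) (s.along (pos ω t'))}

theorem between_comm {n : ℕ} (ω : Config n) (s : Street) (t t' : Node n) :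
    between ω s t t' = between ω s t' t := by
  simp only [between, Set.uIoo_comm]

@[simp] theorem pos_inr {n : ℕ} (ω : Config n) (c : Crossing) : pos ω (.inr c) = c.pos := rfl

theorem notMem_uIoo_left {a b : ℝ} : a ∉ Set.uIoo a b := by
  simpa [Set.uIoo] using le_of_lt

theorem notMem_uIoo_right {a b : ℝ} : b ∉ Set.uIoo a b := by
  simpa [Set.uIoo] using le_of_lt

theorem mem_uIoo_of_mem_uIoo_right {a b m x : ℝ} (hm : m ∈ Set.uIoo a b)
    (hx : x ∈ Set.uIoo m b) : x ∈ Set.uIoo a b := by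
  simp only [Set.uIoo, Set.mem_Ioo, inf_lt_iff, lt_sup_iff] at *
  grind

theorem mem_uIoo_of_mem_uIoo_left {a b m x : ℝ} (hm : m ∈ Set.uIoo a b)
    (hx : x ∈ Set.uIoo a m) : x ∈ Set.uIoo a b ∧ |x - a| < |m - a| := by
  simp only [Set.uIoo, Set.mem_Ioo, inf_lt_iff, lt_sup_iff] at *
  rcases abs_cases (x - a) with h1 | h1 <;> rcases abs_cases (m - a) with h2 | h2 <;>
    rw [h1.1, h2.1] <;> grind

/-- Induction on the number of mobile nodes strictly between: hop to the nearest of them. Nodes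
sharing an abscissa do no harm, because only strictly intermediate nodes block a hop. -/
theorem exists_walk {n : ℕ} (ω : Config n) (s : Street) {t t' : Node n} (hne : t ≠ t')
    (ht : pos ω t ∈ s.carrier) (ht' : pos ω t' ∈ s.carrier) :
    ∃ M : List (Fin n), M.Nodup ∧ (∀ m ∈ M, m ∈ between ω s t t') ∧
      List.IsChain (Hop ω s) (t :: (M.map Sum.inl ++ [t'])) := by
  generalize hN : (between ω s t t').ncard = N
  induction N using Nat.strong_induction_on generalizing t with
  | _ N ih =>
  rcases (between ω s t t').eq_empty_or_nonempty with hb | hb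
  · refine ⟨[], List.nodup_nil, by simp, ?_⟩
    simp only [List.map_nil, List.nil_append, List.isChain_cons_cons, List.isChain_singleton,
      and_true]
    refine ⟨hne, ht, ht', fun i hi hi' => ?_⟩
    have : i ∈ between ω s t t' := ⟨hi, hi'⟩
    simp [hb] at this
  · obtain ⟨m, hm, hmin⟩ := Set.exists_min_image (between ω s t t')
      (fun i => |s.along (ω.1 i) - s.along (pos ω t)|) (Set.toFinite _) hb
    have hsub : between ω s (.inl m) t' ⊆ between ω s t t' := fun i hi =>
      ⟨hi.1, mem_uIoo_of_mem_uIoo_right hm.2 hi.2⟩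
    have hmn : m ∉ between ω s (.inl m) t' := fun hi => notMem_uIoo_left hi.2
    have hcard : (between ω s (.inl m) t').ncard < N := by
      rw [← hN]
      exact Set.ncard_lt_ncard ⟨hsub, fun h => hmn (h hm)⟩ (Set.toFinite _)
    have hne' : (Sum.inl m : Node n) ≠ t' := by
      rintro rfl
      exact notMem_uIoo_right hm.2
    obtain ⟨M, hM, hMb, hMc⟩ := ih _ hcard hne' hm.1 rfl
    refine ⟨m :: M, List.nodup_cons.2 ⟨fun h => hmn (hMb m h), hM⟩, ?_, ?_⟩
    · intro i hi
      rcases List.mem_cons.1 hi with rfl | hi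
      · exact hm
      · exact hsub (hMb i hi)
    · simp only [List.map_cons, List.cons_append, List.isChain_cons_cons]
      refine ⟨⟨?_, ht, hm.1, ?_⟩, hMc⟩
      · rintro rfl
        exact notMem_uIoo_left hm.2
      · intro i hi hi'
        obtain ⟨h1, h2⟩ := mem_uIoo_of_mem_uIoo_left hm.2 hi'
        exact absurd (hmin i ⟨hi, h1⟩) (not_le.2 h2)

/-- The transmissions `L` carry a message from `t` to `t'`; the last node `t'` does not transmit. -/
inductive Trail {n : ℕ} (ω : Config n) : List (Node n × Street) → Node n → Node n → Prop
  | nil (t : Node n) : Trail ω [] t t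
  | cons {t t' t'' : Node n} {s : Street} {L : List (Node n × Street)} (hp : Present ω t)
      (h : Hop ω s t t') (hL : Trail ω L t' t'') : Trail ω ((t, s) :: L) t t''

namespace Trail

variable {n : ℕ} {ω : Config n}

theorem append {L L' : List (Node n × Street)} {t t' t'' : Node n} (h : Trail ω L t t')
    (h' : Trail ω L' t' t'') : Trail ω (L ++ L') t t'' := by
  induction h with
  | nil => exact h'
  | cons hp h _ ih => exact .cons hp h (ih h')

theorem isRoute {L : List (Node n × Street)} {t t' : Node n} (h : Trail ω L t t') {s : Street}
    (hp : Present ω t') (hs : pos ω t' ∈ s.carrier) :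
    IsRoute ω (L ++ [(t', s)]) ∧ (L ++ [(t', s)]).head?.map Prod.fst = some t := by
  induction h with
  | nil => simp [IsRoute, hp, hs]
  | @cons a b c σ L hpa hab hL ih =>
    obtain ⟨⟨h1, h2⟩, h3⟩ := ih hp hs
    refine ⟨⟨?_, ?_⟩, rfl⟩
    · intro e he
      rcases List.mem_cons.1 he with rfl | he
      · exact ⟨hpa, hab.2.1⟩
      · exact h1 e he
    · rw [List.cons_append, List.isChain_cons]
      refine ⟨fun y hy => ?_, h2⟩
      rw [Option.mem_def] at hy
      rw [hy] at h3
      simp only [Option.map_some, Option.some.injEq] at h3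
      simpa [h3] using hab

theorem of_chain {s : Street} {t t' : Node n} {M : List (Fin n)} (hp : Present ω t)
    (h : List.IsChain (Hop ω s) (t :: (M.map Sum.inl ++ [t']))) :
    Trail ω ((t :: M.map Sum.inl).map fun u => (u, s)) t t' := by
  induction M generalizing t with
  | nil =>
    simp only [List.map_nil, List.nil_append, List.isChain_cons_cons, List.isChain_singleton,
      and_true] at h
    exact .cons hp h (.nil _)
  | cons m M ih =>
    simp only [List.map_cons, List.cons_append, List.isChain_cons_cons] at h
    exact .cons hp h.1 (ih trivial h.2)

end Trail

variable {n : ℕ}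

/-! ### Energy of a leg along one street -/

theorem energy_append (Pmax δ : ℝ) (ω : Config n) (L L' : List (Node n × Street)) :
    energy Pmax δ ω (L ++ L') = energy Pmax δ ω L + energy Pmax δ ω L' := by
  simp [energy]

theorem energy_const (Pmax δ : ℝ) (ω : Config n) (L : List (Node n)) (s : Street) :
    energy Pmax δ ω (L.map fun u => (u, s)) = L.length * power Pmax δ ω s := by
  simp only [energy, List.map_map]
  have : ((fun e : Node n × Street => power Pmax δ ω e.2) ∘ fun u => (u, s))
      = fun _ => power Pmax δ ω s := rfl
  rw [this]
  simp

theorem length_le_ncard {M : List (Fin n)} (hM : M.Nodup) {S : Set (Fin n)}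
    (h : ∀ m ∈ M, m ∈ S) : M.length ≤ S.ncard := by
  rw [← List.toFinset_card_of_nodup hM, ← Set.ncard_coe_finset]
  exact Set.ncard_le_ncard (fun i hi => h i (by simpa using hi)) (Set.toFinite _)

theorem power_pos {Pmax : ℝ} (hP : 0 < Pmax) (δ : ℝ) (ω : Config n) (s : Street) :
    0 < power Pmax δ ω s := by
  unfold power
  have : (0 : ℝ) < max 1 (population ω s) := by positivity
  positivity

theorem power_le_div_sq {Pmax δ : ℝ} (hP : 0 < Pmax) (hδ : 2 ≤ δ) (ω : Config n) (s : Street) :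
    power Pmax δ ω s ≤ Pmax / (max 1 (population ω s) : ℝ) ^ 2 := by
  unfold power
  have h1 : (1 : ℝ) ≤ (max 1 (population ω s) : ℝ) := le_max_left _ _
  have h2 : (max 1 (population ω s) : ℝ) ^ (2 : ℝ) ≤ (max 1 (population ω s) : ℝ) ^ δ :=
    Real.rpow_le_rpow_of_exponent_le h1 hδ
  rw [Real.rpow_two] at h2
  gcongr

/-- Here δ ≥ 2 enters: m transmissions of power Pmax/m² cost Pmax/m ≤ Pmax. -/
theorem mul_power_le {Pmax δ : ℝ} (hP : 0 < Pmax) (hδ : 2 ≤ δ) (ω : Config n) (s : Street)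
    {x : ℝ} (hx : x ≤ (max 1 (population ω s) : ℝ)) : x * power Pmax δ ω s ≤ Pmax := by
  set m : ℝ := max 1 (population ω s) with hm
  have h1 : 1 ≤ m := le_max_left _ _
  calc x * power Pmax δ ω s ≤ m * (Pmax / m ^ 2) :=
        mul_le_mul hx (power_le_div_sq hP hδ ω s) (power_pos hP δ ω s).le (by linarith)
    _ = Pmax / m := by field_simp
    _ ≤ Pmax := div_le_self hP.le h1

theorem succ_mul_power_le {Pmax δ : ℝ} (hP : 0 < Pmax) (hδ : 2 ≤ δ) (ω : Config n) (s : Street)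
    {x : ℝ} (hx : x ≤ population ω s + 1) : x * power Pmax δ ω s ≤ 2 * Pmax := by
  have h := mul_power_le hP hδ ω s (x := x / 2) (by
    have h1 : (1 : ℝ) ≤ (max 1 (population ω s) : ℝ) := le_max_left _ _
    have h2 : (population ω s : ℝ) ≤ (max 1 (population ω s) : ℝ) := le_max_right _ _
    linarith)
  linarith

/-- From ten nodes on, (m + 1)/m² ≤ 2/m ≤ 1/5. The threshold 10 is what makes all legs on levels at
most `h` cheap enough for the budget 6·Pmax. -/
theorem succ_mul_power_le_of_population {Pmax δ : ℝ} (hP : 0 < Pmax) (hδ : 2 ≤ δ) (ω : Config n)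
    (s : Street) (hs : 10 ≤ population ω s) {x : ℝ} (hx : x ≤ population ω s + 1) :
    x * power Pmax δ ω s ≤ Pmax / 5 := by
  have hs' : (10 : ℝ) ≤ population ω s := by exact_mod_cast hs
  have hm : (max 1 (population ω s) : ℝ) = population ω s := max_eq_right (by linarith)
  have h := power_le_div_sq hP hδ ω s
  rw [hm] at h
  set m : ℝ := (population ω s : ℝ)
  calc x * power Pmax δ ω s ≤ (2 * m) * (Pmax / m ^ 2) :=
        mul_le_mul (by linarith) h (power_pos hP δ ω s).le (by linarith)
    _ = 2 * Pmax / m := by field_simp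
    _ ≤ 2 * Pmax / 10 := by gcongr
    _ = Pmax / 5 := by ring

theorem between_ncard_le_population (ω : Config n) (s : Street) (t t' : Node n) :
    (between ω s t t').ncard ≤ population ω s :=
  Set.ncard_le_ncard (fun _ hi => hi.1) (Set.toFinite _)

/-- The starting node stands on the street but is not counted as intermediate, so a leg starting at
a mobile node needs at most m transmissions and costs at most Pmax instead of 2·Pmax. -/
theorem between_inl_ncard_lt_population (ω : Config n) (s : Street) (i : Fin n) (t' : Node n)
    (hi : ω.1 i ∈ s.carrier) : (between ω s (.inl i) t').ncard < population ω s := by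
  apply Set.ncard_lt_ncard ⟨fun _ hi => hi.1, fun h => ?_⟩ (Set.toFinite _)
  exact notMem_uIoo_left (h hi).2

/-- The nodes `t` and `t'` can send messages to each other, in both directions with at most `ℓ`
transmissions of total energy at most `E`. -/
def Linked (Pmax δ : ℝ) (ω : Config n) (ℓ E : ℝ) (t t' : Node n) : Prop :=
  (∃ L, Trail ω L t t' ∧ (L.length : ℝ) ≤ ℓ ∧ energy Pmax δ ω L ≤ E) ∧
    ∃ L, Trail ω L t' t ∧ (L.length : ℝ) ≤ ℓ ∧ energy Pmax δ ω L ≤ E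

namespace Linked

variable {Pmax δ ℓ ℓ' E E' : ℝ} {ω : Config n} {t t' t'' : Node n}

theorem symm (h : Linked Pmax δ ω ℓ E t t') : Linked Pmax δ ω ℓ E t' t := ⟨h.2, h.1⟩

theorem trans (h : Linked Pmax δ ω ℓ E t t') (h' : Linked Pmax δ ω ℓ' E' t' t'') :
    Linked Pmax δ ω (ℓ + ℓ') (E + E') t t'' := by
  obtain ⟨⟨L₁, a₁, b₁, c₁⟩, ⟨L₂, a₂, b₂, c₂⟩⟩ := h
  obtain ⟨⟨L₁', a₁', b₁', c₁'⟩, ⟨L₂', a₂', b₂', c₂'⟩⟩ := h'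
  refine ⟨⟨L₁ ++ L₁', a₁.append a₁', ?_, ?_⟩, ⟨L₂' ++ L₂, a₂'.append a₂, ?_, ?_⟩⟩
  · push_cast [List.length_append]; linarith
  · rw [energy_append]; linarith
  · push_cast [List.length_append]; linarith
  · rw [energy_append]; linarith

theorem mono (h : Linked Pmax δ ω ℓ E t t') (hℓ : ℓ ≤ ℓ') (hE : E ≤ E') :
    Linked Pmax δ ω ℓ' E' t t' := by
  obtain ⟨⟨L₁, a₁, b₁, c₁⟩, ⟨L₂, a₂, b₂, c₂⟩⟩ := h
  exact ⟨⟨L₁, a₁, b₁.trans hℓ, c₁.trans hE⟩, ⟨L₂, a₂, b₂.trans hℓ, c₂.trans hE⟩⟩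

theorem of_street (hP : 0 < Pmax) {s : Street} (ht : Present ω t) (ht' : Present ω t')
    (hs : pos ω t ∈ s.carrier) (hs' : pos ω t' ∈ s.carrier)
    (hℓ : ((between ω s t t').ncard : ℝ) + 1 ≤ ℓ)
    (hE : (((between ω s t t').ncard : ℝ) + 1) * power Pmax δ ω s ≤ E) :
    Linked Pmax δ ω ℓ E t t' := by
  have key : ∀ {t t' : Node n}, t ≠ t' → Present ω t → pos ω t ∈ s.carrier →
      pos ω t' ∈ s.carrier → ((between ω s t t').ncard : ℝ) + 1 ≤ ℓ →
      (((between ω s t t').ncard : ℝ) + 1) * power Pmax δ ω s ≤ E →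
      ∃ L, Trail ω L t t' ∧ (L.length : ℝ) ≤ ℓ ∧ energy Pmax δ ω L ≤ E := by
    intro t t' hne ht hs hs' hℓ hE
    obtain ⟨M, hM, hMb, hMc⟩ := exists_walk ω s hne hs hs'
    have hlen : (M.length : ℝ) ≤ (between ω s t t').ncard := by
      exact_mod_cast length_le_ncard hM hMb
    refine ⟨_, Trail.of_chain ht hMc, ?_, ?_⟩
    · simp only [List.length_map, List.length_cons]
      push_cast
      linarith
    · rw [energy_const]
      simp only [List.length_map, List.length_cons]
      push_cast
      exact (mul_le_mul_of_nonneg_right (by linarith) (power_pos hP δ ω s).le).trans hE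
  -- A node cannot hop to itself, so coinciding ends are joined by the empty trail.
  by_cases hne : t = t'
  · subst hne
    have h0 : (0 : ℝ) ≤ (between ω s t t).ncard := Nat.cast_nonneg _
    have h0' : 0 ≤ E := le_trans (mul_nonneg (by linarith) (power_pos hP δ ω s).le) hE
    exact ⟨⟨[], .nil _, by simp; linarith, by simpa [energy] using h0'⟩,
      ⟨[], .nil _, by simp; linarith, by simpa [energy] using h0'⟩⟩
  · refine ⟨key hne ht hs hs' hℓ hE, key (Ne.symm hne) ht' hs' hs ?_ ?_⟩
    · rwa [between_comm]
    · rwa [between_comm]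

end Linked

/-! ### Typical configurations -/

/-- The mobile nodes on the street `s` whose abscissa is in the dyadic interval `(k, j)`. -/
def nodesInCell (ω : Config n) (s : Street) (k j : ℕ) : Set (Fin n) :=
  {i | ω.1 i ∈ s.carrier ∧ s.along (ω.1 i) ∈ dyadicCell k j}

/-- Some relay at the crossing of the street `(d, L)` with a perpendicular street of level `l`
has its abscissa in the dyadic interval `(k, j)`. -/
def RelayInCell (ω : Config n) (d : Bool) (L : Line) (l k j : ℕ) : Prop :=
  ∃ L' : Line, L'.1 = l ∧ L'.coord ∈ dyadicCell k j ∧ 1 ≤ ω.2 (crossingOf d L L')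

/-- The configurations for which short routes are constructed: streets of level at most `h` are
crowded, and every street of level `l` is divided into `2 ^ k l` cells with few mobile nodes,
each of which contains, when `l ≤ h`, a relay towards a street of level `v`. -/
structure IsTypical (ω : Config n) (h v t : ℕ) (k : ℕ → ℕ) : Prop where
  street_unique : ∀ (i : Fin n) (s s' : Street), ω.1 i ∈ s.carrier → ω.1 i ∈ s'.carrier → s = s'
  cell_le : ∀ (s : Street), ∀ j < 2 ^ k s.level, (nodesInCell ω s (k s.level) j).ncard ≤ t
  le_population : ∀ s : Street, s.level ≤ h → 10 ≤ population ω s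
  relay_in_cell : ∀ (d : Bool) (L : Line), L.1 ≤ h → ∀ j < 2 ^ k L.1,
    RelayInCell ω d L v (k L.1) j
  relay_in_half : ∀ (d : Bool) (L : Line), L.1 = v → ∀ j < 2, RelayInCell ω d L h 1 j
  relay_at_crossing : ∀ (d : Bool) (L L' : Line), L.1 = h → L'.1 = h →
    1 ≤ ω.2 (crossingOf d L L')

/-! ### Streets of the nodes of G_1 -/

/-- Only a relay can change streets, because a mobile node stands on one street. -/
theorem exists_isRoute_last {ω : Config n}
    (hu : ∀ (i : Fin n) (s s' : Street), ω.1 i ∈ s.carrier → ω.1 i ∈ s'.carrier → s = s')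
    (T : List (Node n × Street)) (i : Fin n) (s : Street) (hT : IsRoute ω ((.inl i, s) :: T))
    (h0 : relayCount T = 0) :
    ∃ m, ((.inl i, s) :: T).getLast?.map Prod.fst = some (Sum.inl m) ∧ ω.1 m ∈ s.carrier := by
  induction T generalizing i s with
  | nil => exact ⟨i, rfl, (hT.1 (.inl i, s) (by simp)).2⟩
  | cons e T ih =>
    obtain ⟨t, s'⟩ := e
    have hc := hT.2
    rw [List.isChain_cons_cons] at hc
    cases t with
    | inr c => simp [relayCount] at h0
    | inl m =>
      have hs : s' = s := hu m _ _ (hT.1 (.inl m, s') (by simp)).2 hc.1.2.2.1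
      subst hs
      obtain ⟨m', h1, h2⟩ := ih m s' ⟨fun e he => hT.1 e (List.mem_cons_of_mem _ he), hc.2⟩
        (by simpa [relayCount] using h0)
      exact ⟨m', by rwa [List.getLast?_cons_cons], h2⟩

/-- Up to its first relay the path stays on `s`; after it, no relay remains, so the path stays on
one more street. If that street is really used, the final mobile node shows that it has level 0,
hence the relay lies both on `s` and on the central cross. -/
theorem level_eq_zero_or_exists_relay {ω : Config n}
    (hu : ∀ (i : Fin n) (s s' : Street), ω.1 i ∈ s.carrier → ω.1 i ∈ s'.carrier → s = s')
    (T : List (Node n × Street)) (i : Fin n) (s : Street) (hT : IsRoute ω ((.inl i, s) :: T))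
    (h1 : relayCount T ≤ 1) {t : Node n}
    (ht : ((.inl i, s) :: T).getLast?.map Prod.fst = some t) (htc : pos ω t ∈ centralCross) :
    s.level = 0 ∨ ∃ c : Crossing, 1 ≤ ω.2 c ∧ c.pos ∈ s.carrier ∧ c.pos ∈ centralCross := by
  induction T generalizing i s with
  | nil =>
    simp only [List.getLast?_singleton, Option.map_some, Option.some.injEq] at ht
    subst ht
    obtain ⟨s₀, h0, hs₀⟩ := mem_centralCross.1 htc
    left
    rw [hu i s s₀ (hT.1 (.inl i, s) (by simp)).2 hs₀, h0]
  | cons e T ih =>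
    obtain ⟨t', s'⟩ := e
    have hc := hT.2
    rw [List.isChain_cons_cons] at hc
    have hT' : IsRoute ω ((t', s') :: T) := ⟨fun e he => hT.1 e (List.mem_cons_of_mem _ he), hc.2⟩
    rw [List.getLast?_cons_cons] at ht
    cases t' with
    | inl m =>
      have hs : s' = s := hu m _ _ (hT.1 (.inl m, s') (by simp)).2 hc.1.2.2.1
      subst hs
      exact ih m s' hT' (by simpa [relayCount] using h1) ht
    | inr c =>
      right
      refine ⟨c, (hT'.1 (.inr c, s') (by simp)).1, hc.1.2.2.1, ?_⟩
      have h0 : relayCount T = 0 := by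
        have : relayCount ((.inr c, s') :: T) = relayCount T + 1 :=
          List.countP_cons_of_pos rfl
        have h1' : relayCount ((.inr c, s') :: T) ≤ 1 := h1
        omega
      cases T with
      | nil =>
        simp only [List.getLast?_singleton, Option.map_some, Option.some.injEq] at ht
        subst ht
        exact htc
      | cons e T =>
        obtain ⟨t'', s''⟩ := e
        have hc' := hT'.2
        rw [List.isChain_cons_cons] at hc'
        rw [List.getLast?_cons_cons] at ht
        cases t'' with
        | inr c' => simp [relayCount] at h0
        | inl m =>
          have hs : s'' = s' :=
            hu m _ _ (hT'.1 (.inl m, s'') (by simp)).2 hc'.1.2.2.1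
          subst hs
          obtain ⟨m', e1, e2⟩ := exists_isRoute_last hu T m s''
            ⟨fun e he => hT'.1 e (List.mem_cons_of_mem _ he), hc'.2⟩
            (by simpa [relayCount] using h0)
          rw [e1] at ht
          simp only [Option.some.injEq] at ht
          subst ht
          obtain ⟨s₀, h0', hs₀⟩ := mem_centralCross.1 htc
          have := hu m' s'' s₀ e2 hs₀
          exact mem_centralCross.2 ⟨s'', this ▸ h0', hc'.1.2.1⟩

theorem exists_street_of_mem_giant {Pmax δ E : ℝ} {ω : Config n}
    (hu : ∀ (i : Fin n) (s s' : Street), ω.1 i ∈ s.carrier → ω.1 i ∈ s'.carrier → s = s')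
    {i : Fin n} (hi : i ∈ giant Pmax δ ω 1 E) :
    ∃ d L, ω.1 i ∈ (Street.ofDir d L).carrier ∧
      (L.1 = 0 ∨ ∃ L₀ : Line, L₀.1 = 0 ∧ 1 ≤ ω.2 (crossingOf d L L₀)) := by
  obtain ⟨T, hT, hhead, ⟨t, ht, htc⟩, -, hr⟩ := hi
  cases T with
  | nil => simp at hhead
  | cons e T =>
    obtain ⟨t₀, s⟩ := e
    simp only [List.head?_cons, Option.map_some, Option.some.injEq] at hhead
    subst hhead
    obtain ⟨d, L, rfl⟩ := s.exists_ofDir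
    refine ⟨d, L, (hT.1 (.inl i, Street.ofDir d L) List.mem_cons_self).2, ?_⟩
    rcases level_eq_zero_or_exists_relay hu T i _ hT (by simpa [relayCount] using hr) ht htc with
      h | ⟨c, hc, hcs, hcc⟩
    · left; simpa using h
    · obtain ⟨L', rfl⟩ := eq_crossingOf_of_mem hcs
      obtain ⟨s₀, h0, hs₀⟩ := mem_centralCross.1 hcc
      obtain ⟨d₀, L₀, rfl⟩ := s₀.exists_ofDir
      rw [Street.level_ofDir] at h0
      by_cases hd : d₀ = d
      · subst hd
        left
        rw [Street.carrier_inter_parallel hcs hs₀, h0]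
      · have hd' : d₀ = !d := by cases d <;> cases d₀ <;> simp_all
        subst hd'
        right
        exact ⟨L', by rw [Street.carrier_inter_parallel (crossingOf_pos_mem' d L L') hs₀, h0], hc⟩

/-! ### Routes between nodes of G_1 in a typical configuration -/

namespace IsTypical

variable {ω : Config n} {h v t : ℕ} {k : ℕ → ℕ}

theorem between_le (G : IsTypical ω h v t k) {s : Street} {j : ℕ} (hj : j < 2 ^ k s.level)
    {a b : Node n} (ha : s.along (pos ω a) ∈ dyadicCell (k s.level) j)
    (hb : s.along (pos ω b) ∈ dyadicCell (k s.level) j) : (between ω s a b).ncard ≤ t := by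
  refine le_trans (Set.ncard_le_ncard ?_ (Set.toFinite _)) (G.cell_le s j hj)
  rintro i ⟨hi, hi'⟩
  refine ⟨hi, ?_⟩
  simp only [dyadicCell, Set.uIoo, Set.mem_Ioo, inf_lt_iff, lt_sup_iff, Set.mem_Icc] at *
  constructor
  · rcases hi'.1 with h | h <;> linarith
  · rcases hi'.2 with h | h <;> linarith

theorem between_le_of_level (G : IsTypical ω h v t k) (hk : ∀ l, h ≤ l → k l = 0) {s : Street}
    (hs : h ≤ s.level) {a b : Node n} (ha : pos ω a ∈ s.carrier) (hb : pos ω b ∈ s.carrier) :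
    (between ω s a b).ncard ≤ t := by
  apply G.between_le (j := 0) (by positivity)
  · rw [hk _ hs, dyadicCell_zero_zero]; exact (Street.mem_carrier.1 ha).2
  · rw [hk _ hs, dyadicCell_zero_zero]; exact (Street.mem_carrier.1 hb).2

theorem linked_of_level_le {Pmax δ : ℝ} (hP : 0 < Pmax) (hδ : 2 ≤ δ) (G : IsTypical ω h v t k)
    {s : Street} (hs : s.level ≤ h) {a b : Node n} (ha : Present ω a) (hb : Present ω b)
    (has : pos ω a ∈ s.carrier) (hbs : pos ω b ∈ s.carrier) (hab : (between ω s a b).ncard ≤ t) :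
    Linked Pmax δ ω (t + 1) (Pmax / 5) a b := by
  have h1 : ((between ω s a b).ncard : ℝ) ≤ t := by exact_mod_cast hab
  have h2 : ((between ω s a b).ncard : ℝ) ≤ population ω s := by
    exact_mod_cast between_ncard_le_population ω s a b
  exact Linked.of_street hP ha hb has hbs (by linarith)
    (succ_mul_power_le_of_population hP hδ ω s (G.le_population s hs) (by linarith))

theorem exists_relay_near (G : IsTypical ω h v t k) {d : Bool} {L : Line} (hL : L.1 ≤ h)
    {a : Node n} (ha : pos ω a ∈ (Street.ofDir d L).carrier) :
    ∃ U : Line, U.1 = v ∧ 1 ≤ ω.2 (crossingOf d L U) ∧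
      (between ω (Street.ofDir d L) a (.inr (crossingOf d L U))).ncard ≤ t := by
  obtain ⟨j, hj, haj⟩ := exists_mem_dyadicCell (k L.1) (Street.mem_carrier.1 ha).2
  obtain ⟨U, hU, hUj, hp⟩ := G.relay_in_cell d L hL j hj
  refine ⟨U, hU, hp, G.between_le (j := j) (by simpa using hj) (by simpa using haj) ?_⟩
  simpa [along_crossingOf] using hUj

/-- Seen from the middle of a street of level `v`, one of the two halves of the street contains a
relay towards level `h` and at most half of the mobile nodes. -/
theorem exists_relay_in_half (G : IsTypical ω h v t k) {d : Bool} {L U : Line} (hU : U.1 = v)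
    (hL : L.1 = 0) :
    ∃ H : Line, H.1 = h ∧ 1 ≤ ω.2 (crossingOf (!d) U H) ∧
      2 * (between ω (Street.ofDir (!d) U) (.inr (crossingOf d L U))
        (.inr (crossingOf (!d) U H))).ncard ≤ population ω (Street.ofDir (!d) U) := by
  obtain ⟨H₀, h0, c0, p0⟩ := G.relay_in_half (!d) U hU 0 (by norm_num)
  obtain ⟨H₁, h1, c1, p1⟩ := G.relay_in_half (!d) U hU 1 (by norm_num)
  set s := Street.ofDir (!d) U with hs
  set B₀ := between ω s (.inr (crossingOf d L U)) (.inr (crossingOf (!d) U H₀)) with hB₀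
  set B₁ := between ω s (.inr (crossingOf d L U)) (.inr (crossingOf (!d) U H₁)) with hB₁
  have hdisj : Disjoint B₀ B₁ := by
    rw [Set.disjoint_left]
    rintro i ⟨-, hi⟩ ⟨-, hi'⟩
    -- The central cross meets the street at abscissa 1/2, and the two relays lie on opposite sides
    -- of it; hence the two sets of intermediate nodes are disjoint.
    simp only [pos_inr, hs, along_crossingOf, along_crossingOf', Line.coord_of_level_zero hL,
      Set.uIoo, Set.mem_Ioo, inf_lt_iff, lt_sup_iff] at hi hi'
    simp only [dyadicCell, Set.mem_Icc] at c0 c1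
    norm_num at c0 c1
    rcases hi.2 with h | h <;> rcases hi'.1 with h' | h' <;> linarith
  have hsum : B₀.ncard + B₁.ncard ≤ population ω s := by
    rw [← Set.ncard_union_eq hdisj (Set.toFinite _) (Set.toFinite _)]
    exact Set.ncard_le_ncard (Set.union_subset (fun _ hi => hi.1) fun _ hi => hi.1)
      (Set.toFinite _)
  by_cases hle : 2 * B₀.ncard ≤ population ω s
  · exact ⟨H₀, h0, p0, hle⟩
  · exact ⟨H₁, h1, p1, show 2 * B₁.ncard ≤ _ by omega⟩

/-- Two legs: inside the cell to a relay towards level `v` (cost Pmax/5), then along the street of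
level `v` to a relay of level `h`. The second leg costs 2·Pmax in general, but only Pmax from the
central cross, where the less populated half can be chosen. This saving pays for the additional leg
of nodes on levels above `h`. -/
theorem exists_linked_relay {Pmax δ : ℝ} (hP : 0 < Pmax) (hδ : 2 ≤ δ) (G : IsTypical ω h v t k)
    (hk : ∀ l, h ≤ l → k l = 0) (hv : h ≤ v) {d : Bool} {L : Line} (hL : L.1 ≤ h) {a : Node n}
    (hp : Present ω a) (ha : pos ω a ∈ (Street.ofDir d L).carrier) :
    ∃ (H : Line) (c : Crossing), H.1 = h ∧ 1 ≤ ω.2 c ∧ c.pos ∈ (Street.ofDir d H).carrier ∧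
      Linked Pmax δ ω (2 * (t + 1)) ((if L.1 = 0 then 6 / 5 else 11 / 5) * Pmax) a (.inr c) := by
  obtain ⟨U, hU, hpU, hb⟩ := G.exists_relay_near hL ha
  have l1 : Linked Pmax δ ω (t + 1) (Pmax / 5) a (.inr (crossingOf d L U)) :=
    G.linked_of_level_le hP hδ (by simpa using hL) hp hpU ha (crossingOf_pos_mem d L U) hb
  have key : ∀ (H : Line) (E : ℝ), H.1 = h → 1 ≤ ω.2 (crossingOf (!d) U H) →
      (((between ω (Street.ofDir (!d) U) (.inr (crossingOf d L U))
        (.inr (crossingOf (!d) U H))).ncard : ℝ) + 1) * power Pmax δ ω (Street.ofDir (!d) U) ≤ E →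
      Linked Pmax δ ω (2 * (t + 1)) (Pmax / 5 + E) a (.inr (crossingOf (!d) U H)) := by
    intro H E hH hpH hE
    have hbt : (between ω (Street.ofDir (!d) U) (.inr (crossingOf d L U))
        (.inr (crossingOf (!d) U H))).ncard ≤ t :=
      G.between_le_of_level hk (by simp [hU, hv]) (crossingOf_pos_mem' d L U)
        (crossingOf_pos_mem (!d) U H)
    refine (l1.trans (Linked.of_street hP (s := Street.ofDir (!d) U) hpU
      (t' := .inr (crossingOf (!d) U H)) hpH
      (crossingOf_pos_mem' d L U) (crossingOf_pos_mem (!d) U H) (ℓ := t + 1) ?_ hE)).mono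
      (by linarith) le_rfl
    have : ((between ω (Street.ofDir (!d) U) (.inr (crossingOf d L U))
        (.inr (crossingOf (!d) U H))).ncard : ℝ) ≤ t := by exact_mod_cast hbt
    linarith
  have hmem : ∀ H, (crossingOf (!d) U H).pos ∈ (Street.ofDir d H).carrier := fun H => by
    simpa using crossingOf_pos_mem' (!d) U H
  by_cases h0 : L.1 = 0
  · obtain ⟨H, hH, hpH, hhalf⟩ := G.exists_relay_in_half (d := d) hU h0
    refine ⟨H, _, hH, hpH, hmem H, ?_⟩
    rw [if_pos h0]
    refine (key H Pmax hH hpH (mul_power_le hP hδ ω _ ?_)).mono le_rfl (by linarith)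
    have h1 : (1 : ℝ) ≤ (max 1 (population ω (Street.ofDir (!d) U)) : ℝ) := le_max_left _ _
    have h2 : (population ω (Street.ofDir (!d) U) : ℝ)
      ≤ (max 1 (population ω (Street.ofDir (!d) U)) : ℝ) := le_max_right _ _
    rcases Nat.eq_zero_or_pos (between ω (Street.ofDir (!d) U) (.inr (crossingOf d L U))
        (.inr (crossingOf (!d) U H))).ncard with hz | hz
    · rw [hz]; push_cast; linarith
    · refine le_trans ?_ h2
      exact_mod_cast (show _ + 1 ≤ _ by omega)
  · obtain ⟨H, hH, -, hpH⟩ := G.relay_in_half (!d) U hU 0 (by norm_num)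
    refine ⟨H, _, hH, hpH, hmem H, ?_⟩
    rw [if_neg h0]
    refine (key H (2 * Pmax) hH hpH (succ_mul_power_le hP hδ ω _ ?_)).mono le_rfl (by linarith)
    have := between_ncard_le_population ω (Street.ofDir (!d) U) (.inr (crossingOf d L U))
      (.inr (crossingOf (!d) U H))
    gcongr

theorem exists_linked_relay_of_mem_giant {Pmax δ E : ℝ} (hP : 0 < Pmax) (hδ : 2 ≤ δ)
    (G : IsTypical ω h v t k) (hk : ∀ l, h ≤ l → k l = 0) (hv : h ≤ v) {i : Fin n}
    (hi : i ∈ giant Pmax δ ω 1 E) :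
    ∃ (d : Bool) (H : Line) (c : Crossing), H.1 = h ∧ 1 ≤ ω.2 c ∧
      c.pos ∈ (Street.ofDir d H).carrier ∧
      Linked Pmax δ ω (3 * (t + 1)) (11 / 5 * Pmax) (.inl i) (.inr c) := by
  obtain ⟨d, L, hiL, hr⟩ := exists_street_of_mem_giant G.street_unique hi
  have ht : (0 : ℝ) ≤ t := Nat.cast_nonneg t
  by_cases hL : L.1 ≤ h
  · obtain ⟨H, c, hH, hc, hcH, hl⟩ :=
      G.exists_linked_relay hP hδ hk hv hL (a := .inl i) trivial hiL
    refine ⟨d, H, c, hH, hc, hcH, hl.mono (by linarith) ?_⟩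
    split_ifs <;> linarith
  -- Above level `h` the relay on the central cross is used: the first leg costs Pmax and the
  -- continuation from level 0 costs 6/5·Pmax, again 11/5·Pmax in all.
  · obtain ⟨L₀, h0, hp0⟩ := hr.resolve_left (by omega)
    have hbt : (between ω (Street.ofDir d L) (.inl i) (.inr (crossingOf d L L₀))).ncard ≤ t :=
      G.between_le_of_level hk (by simp; omega) hiL (crossingOf_pos_mem d L L₀)
    have hbt' : ((between ω (Street.ofDir d L) (.inl i) (.inr (crossingOf d L L₀))).ncard : ℝ) ≤ t :=
      by exact_mod_cast hbt
    have hlt := between_inl_ncard_lt_population ω (Street.ofDir d L) i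
      (.inr (crossingOf d L L₀)) hiL
    have l1 : Linked Pmax δ ω (t + 1) Pmax (.inl i) (.inr (crossingOf d L L₀)) := by
      refine Linked.of_street hP (s := Street.ofDir d L) trivial hp0 hiL
        (crossingOf_pos_mem d L L₀) (by linarith) (mul_power_le hP hδ ω _ (le_trans ?_
          (le_max_right _ _)))
      exact_mod_cast hlt
    obtain ⟨H, c, hH, hc, hcH, hl⟩ := G.exists_linked_relay hP hδ hk hv (d := !d) (L := L₀)
      (by omega) (a := .inr (crossingOf d L L₀)) hp0 (crossingOf_pos_mem' d L L₀)
    rw [if_pos h0] at hl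
    exact ⟨!d, H, c, hH, hc, hcH, (l1.trans hl).mono (by linarith) (by linarith)⟩

theorem linked_of_level_eq {Pmax δ : ℝ} (hP : 0 < Pmax) (hδ : 2 ≤ δ)
    (G : IsTypical ω h v t k) (hk : ∀ l, h ≤ l → k l = 0) {d d' : Bool} {H H' : Line}
    (hH : H.1 = h) (hH' : H'.1 = h) {c c' : Crossing} (hc : 1 ≤ ω.2 c) (hc' : 1 ≤ ω.2 c')
    (hcH : c.pos ∈ (Street.ofDir d H).carrier) (hcH' : c'.pos ∈ (Street.ofDir d' H').carrier) :
    Linked Pmax δ ω (3 * (t + 1)) (3 / 5 * Pmax) (.inr c) (.inr c') := by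
  have ht : (0 : ℝ) ≤ t := Nat.cast_nonneg t
  have leg : ∀ {d : Bool} {H : Line} {c c' : Crossing}, H.1 = h → 1 ≤ ω.2 c → 1 ≤ ω.2 c' →
      c.pos ∈ (Street.ofDir d H).carrier → c'.pos ∈ (Street.ofDir d H).carrier →
      Linked Pmax δ ω (t + 1) (Pmax / 5) (.inr c) (.inr c') := by
    intro d H c c' hH hc hc' hcH hcH'
    exact G.linked_of_level_le hP hδ (s := Street.ofDir d H) (by simp [hH]) hc hc' hcH hcH'
      (G.between_le_of_level hk (by simp [hH]) hcH hcH')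
  by_cases hd : d' = d
  · subst hd
    -- Parallel streets are joined through a third street of level `h`, the perpendicular one on the
    -- line `H`.
    have p1 := G.relay_at_crossing d' H H hH hH
    have p2 := G.relay_at_crossing d' H' H hH' hH
    exact (((leg hH hc p1 hcH (crossingOf_pos_mem d' H H)).trans
      (leg hH p1 p2 (crossingOf_pos_mem' d' H H) (crossingOf_pos_mem' d' H' H))).trans
      (leg hH' p2 hc' (crossingOf_pos_mem d' H' H) hcH')).mono (by linarith) (by linarith)
  · have hd' : d' = !d := by cases d <;> cases d' <;> simp_all
    subst hd'
    have p := G.relay_at_crossing d H H' hH hH'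
    exact ((leg hH hc p hcH (crossingOf_pos_mem d H H')).trans
      (leg hH' p hc' (crossingOf_pos_mem' d H H') hcH')).mono (by linarith) (by linarith)

theorem exists_route_of_mem_giant {Pmax δ E : ℝ} (hP : 0 < Pmax) (hδ : 2 ≤ δ)
    (G : IsTypical ω h v t k) (hk : ∀ l, h ≤ l → k l = 0) (hv : h ≤ v) {i j : Fin n}
    (hi : i ∈ giant Pmax δ ω 1 E) (hj : j ∈ giant Pmax δ ω 1 E) :
    ∃ T, IsRouteBetween Pmax δ ω (6 * Pmax) i j T ∧ (T.length : ℝ) ≤ 9 * (t + 1) + 1 := by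
  obtain ⟨d, H, c, hH, hc, hcH, l1⟩ := G.exists_linked_relay_of_mem_giant hP hδ hk hv hi
  obtain ⟨d', H', c', hH', hc', hcH', l2⟩ := G.exists_linked_relay_of_mem_giant hP hδ hk hv hj
  -- The budget is 11/5 + 3/5 + 11/5 = 5 times Pmax; the sixth Pmax pays for the last node, which
  -- also counts in the energy.
  obtain ⟨⟨L, hL, hLl, hLE⟩, -⟩ :=
    (l1.trans (G.linked_of_level_eq hP hδ hk hH hH' hc hc' hcH hcH')).trans l2.symm
  obtain ⟨e, M, hjM, -⟩ := exists_street_of_mem_giant G.street_unique hj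
  obtain ⟨hr, hh⟩ := hL.isRoute (s := Street.ofDir e M) trivial hjM
  refine ⟨_, ⟨hr, hh, by simp, ?_⟩, ?_⟩
  · rw [energy_append]
    have := energy_const Pmax δ ω [.inl j] (Street.ofDir e M)
    simp only [List.map_cons, List.map_nil] at this
    rw [this]
    have := mul_power_le hP hδ ω (Street.ofDir e M) (x := 1) (le_max_left _ _)
    simp only [List.length_singleton, Nat.cast_one]
    linarith
  · push_cast [List.length_append, List.length_singleton]
    linarith

end IsTypical

/-! ### Routes through five relays -/

/-- Mobile nodes and relays can be checked separately: the former are distinguished by their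
streets, the latter by their levels. -/
theorem nodup_of_nodup_filterMap {α β : Type*} (l : List (α ⊕ β))
    (h₁ : (l.filterMap Sum.getLeft?).Nodup) (h₂ : (l.filterMap Sum.getRight?).Nodup) :
    l.Nodup := by
  induction l with
  | nil => exact List.nodup_nil
  | cons x l ih =>
    cases x with
    | inl a =>
      simp only [List.filterMap_cons, Sum.getLeft?_inl, Sum.getRight?_inl, List.nodup_cons,
        List.mem_filterMap] at h₁ h₂
      exact List.nodup_cons.2 ⟨fun h => h₁.1 ⟨_, h, rfl⟩, ih h₁.2 h₂⟩
    | inr b =>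
      simp only [List.filterMap_cons, Sum.getLeft?_inr, Sum.getRight?_inr, List.nodup_cons,
        List.mem_filterMap] at h₁ h₂
      exact List.nodup_cons.2 ⟨fun h => h₂.1 ⟨_, h, rfl⟩, ih h₁ h₂.2⟩

theorem filterMap_getLeft_map_inl {α β : Type*} (l : List α) :
    (l.map (Sum.inl : α → α ⊕ β)).filterMap Sum.getLeft? = l := by
  induction l <;> simp_all

theorem filterMap_getRight_map_inl {α β : Type*} (l : List α) :
    (l.map (Sum.inl : α → α ⊕ β)).filterMap Sum.getRight? = [] := by
  induction l <;> simp_all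

/-- A leg of a route: `t` and then the mobile nodes `M` transmit along the street `s`. -/
def leg (s : Street) (t : Node n) (M : List (Fin n)) : List (Node n × Street) :=
  (t :: M.map Sum.inl).map fun u => (u, s)

@[simp] theorem map_fst_leg (s : Street) (t : Node n) (M : List (Fin n)) :
    (leg s t M).map Prod.fst = t :: M.map Sum.inl := by
  simp [leg, Function.comp_def]

@[simp] theorem length_leg (s : Street) (t : Node n) (M : List (Fin n)) :
    (leg s t M).length = M.length + 1 := by
  simp [leg]

theorem relayCount_append (L L' : List (Node n × Street)) :
    relayCount (L ++ L') = relayCount L + relayCount L' := by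
  simp [relayCount]

theorem relayCount_leg (s : Street) (t : Node n) (M : List (Fin n)) :
    relayCount (leg s t M) = if t.isRight then 1 else 0 := by
  have : List.countP ((fun e : Node n × Street => e.1.isRight) ∘ fun u => (u, s))
      (M.map Sum.inl) = 0 := by
    rw [List.countP_eq_zero]
    intro a ha
    obtain ⟨m, -, rfl⟩ := List.mem_map.1 ha
    simp
  rw [relayCount, leg, List.countP_map, List.countP_cons, this]
  simp

theorem energy_leg (Pmax δ : ℝ) (ω : Config n) (s : Street) (t : Node n) (M : List (Fin n)) :
    energy Pmax δ ω (leg s t M) = (M.length + 1) * power Pmax δ ω s := by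
  rw [leg, energy_const]
  simp

theorem exists_leg (ω : Config n) (s : Street) {a b : Node n} (hne : a ≠ b) (hp : Present ω a)
    (ha : pos ω a ∈ s.carrier) (hb : pos ω b ∈ s.carrier) :
    ∃ M : List (Fin n), M.Nodup ∧ (∀ m ∈ M, ω.1 m ∈ s.carrier) ∧ (∀ m ∈ M, m ∈ between ω s a b) ∧
      M.length ≤ (between ω s a b).ncard ∧ Trail ω (leg s a M) a b := by
  obtain ⟨M, h1, h2, h3⟩ := exists_walk ω s hne ha hb
  exact ⟨M, h1, fun m hm => (h2 m hm).1, h2, length_le_ncard h1 h2, Trail.of_chain hp h3⟩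

/-- The levels of the two streets of a crossing, that of direction `d` first. -/
def levels (d : Bool) (c : Crossing) : ℕ × ℕ :=
  if d then (c.row.1, c.col.1) else (c.col.1, c.row.1)

theorem levels_crossingOf (d : Bool) (L L' : Line) : levels d (crossingOf d L L') = (L.1, L'.1) := by
  cases d <;> rfl

theorem levels_crossingOf_not (d : Bool) (L L' : Line) :
    levels d (crossingOf (!d) L L') = (L'.1, L.1) := by
  cases d <;> rfl

/-- The level of a street and its direction. -/
def Street.levelDir : Street → ℕ × Bool
  | .horizontal L => (L.1, true)
  | .vertical L => (L.1, false)

theorem Street.levelDir_ofDir (d : Bool) (L : Line) :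
    (Street.ofDir d L).levelDir = (L.1, d) := by
  cases d <;> rfl

namespace IsTypical

variable {ω : Config n} {h v t : ℕ} {k : ℕ → ℕ}

theorem disjoint_of_streets_ne (G : IsTypical ω h v t k) {s s' : Street} (hs : s ≠ s')
    {M M' : List (Fin n)} (hM : ∀ m ∈ M, ω.1 m ∈ s.carrier) (hM' : ∀ m ∈ M', ω.1 m ∈ s'.carrier) :
    List.Disjoint M M' :=
  fun _ h1 h2 => hs (G.street_unique _ _ _ (hM _ h1) (hM' _ h2))

/-- The six legs run on levels 0, `v`, `h`, `h`, `v`, 0 with alternating directions. As 0 < `h` <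
`v`, the pairs of level and direction are distinct, and so are the level pairs of the five relays.
The energy is at most (4·1/5 + 2·2 + 1)·Pmax = 29/5·Pmax, so neither half of a street of level `v`
has to be preferred. -/
theorem exists_route_of_cross {Pmax δ : ℝ} (hP : 0 < Pmax) (hδ : 2 ≤ δ)
    (G : IsTypical ω h v t k) (hk : ∀ l, h ≤ l → k l = 0) (h0 : 0 < h) (hv : h < v) {i j : Fin n}
    {d : Bool} {A B : Line} (hA : A.1 = 0) (hB : B.1 = 0)
    (hi : ω.1 i ∈ (Street.ofDir d A).carrier) (hj : ω.1 j ∈ (Street.ofDir (!d) B).carrier) :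
    ∃ T, IsRouteBetween Pmax δ ω (6 * Pmax) i j T ∧ (T.map Prod.fst).Nodup ∧ relayCount T = 5 ∧
      (T.length : ℝ) ≤ 9 * (t + 1) + 1 := by
  obtain ⟨U, hU, p1, b0⟩ := G.exists_relay_near (a := .inl i) (by omega) hi
  obtain ⟨H, hH, -, p2⟩ := G.relay_in_half (!d) U hU 0 (by norm_num)
  obtain ⟨U', hU', p5, b5⟩ := G.exists_relay_near (a := .inl j) (by omega) hj
  obtain ⟨H', hH', -, p4⟩ := G.relay_in_half d U' hU' 0 (by norm_num)
  have p3 := G.relay_at_crossing d H H' hH hH'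
  rw [between_comm] at b5
  set s₀ := Street.ofDir d A with hs₀
  set s₁ := Street.ofDir (!d) U with hs₁
  set s₂ := Street.ofDir d H with hs₂
  set s₃ := Street.ofDir (!d) H' with hs₃
  set s₄ := Street.ofDir d U' with hs₄
  set s₅ := Street.ofDir (!d) B with hs₅
  set c₁ := crossingOf d A U with hc₁
  set c₂ := crossingOf (!d) U H with hc₂
  set c₃ := crossingOf d H H' with hc₃
  set c₄ := crossingOf d U' H' with hc₄
  set c₅ := crossingOf (!d) B U' with hc₅
  have e1 : levels d c₁ = (0, v) := by rw [hc₁, levels_crossingOf, hA, hU]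
  have e2 : levels d c₂ = (h, v) := by rw [hc₂, levels_crossingOf_not, hH, hU]
  have e3 : levels d c₃ = (h, h) := by rw [hc₃, levels_crossingOf, hH, hH']
  have e4 : levels d c₄ = (v, h) := by rw [hc₄, levels_crossingOf, hU', hH']
  have e5 : levels d c₅ = (v, 0) := by rw [hc₅, levels_crossingOf_not, hU', hB]
  have hcne : [c₁, c₂, c₃, c₄, c₅].Nodup := by
    apply List.Nodup.of_map (levels d)
    simp only [List.map_cons, List.map_nil, e1, e2, e3, e4, e5]
    simp
    omega
  have hsne : [s₀, s₁, s₂, s₃, s₄, s₅].Nodup := by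
    apply List.Nodup.of_map Street.levelDir
    simp only [List.map_cons, List.map_nil, hs₀, hs₁, hs₂, hs₃, hs₄, hs₅, Street.levelDir_ofDir,
      hA, hB, hU, hU', hH, hH']
    cases d <;> simp <;> omega
  have m1 : c₁.pos ∈ s₀.carrier := crossingOf_pos_mem d A U
  have m1' : c₁.pos ∈ s₁.carrier := crossingOf_pos_mem' d A U
  have m2 : c₂.pos ∈ s₁.carrier := crossingOf_pos_mem (!d) U H
  have m2' : c₂.pos ∈ s₂.carrier := by simpa using crossingOf_pos_mem' (!d) U H
  have m3 : c₃.pos ∈ s₂.carrier := crossingOf_pos_mem d H H'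
  have m3' : c₃.pos ∈ s₃.carrier := crossingOf_pos_mem' d H H'
  have m4 : c₄.pos ∈ s₃.carrier := crossingOf_pos_mem' d U' H'
  have m4' : c₄.pos ∈ s₄.carrier := crossingOf_pos_mem d U' H'
  have m5 : c₅.pos ∈ s₄.carrier := by simpa using crossingOf_pos_mem' (!d) B U'
  have m5' : c₅.pos ∈ s₅.carrier := crossingOf_pos_mem (!d) B U'
  have hcne' := hcne
  simp only [List.nodup_cons, List.mem_cons, List.not_mem_nil, or_false, not_or] at hcne'
  obtain ⟨⟨n12, -⟩, ⟨n23, -⟩, ⟨n34, -⟩, n45, -⟩ := hcne'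
  obtain ⟨M₀, nd0, on0, bt0, l0, tr0⟩ := exists_leg ω s₀ (a := .inl i) (b := .inr c₁)
    (by simp) trivial hi m1
  obtain ⟨M₁, nd1, on1, -, l1, tr1⟩ := exists_leg ω s₁ (a := .inr c₁) (b := .inr c₂)
    (by simpa using n12) p1 m1' m2
  obtain ⟨M₂, nd2, on2, -, l2, tr2⟩ := exists_leg ω s₂ (a := .inr c₂) (b := .inr c₃)
    (by simpa using n23) p2 m2' m3
  obtain ⟨M₃, nd3, on3, -, l3, tr3⟩ := exists_leg ω s₃ (a := .inr c₃) (b := .inr c₄)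
    (by simpa using n34) p3 m3' m4
  obtain ⟨M₄, nd4, on4, -, l4, tr4⟩ := exists_leg ω s₄ (a := .inr c₄) (b := .inr c₅)
    (by simpa using n45) p4 m4' m5
  obtain ⟨M₅, nd5, on5, bt5, l5, tr5⟩ := exists_leg ω s₅ (a := .inr c₅) (b := .inl j)
    (by simp) p5 m5' hj
  have lev : ∀ {s : Street} {a b : Node n}, h ≤ s.level → pos ω a ∈ s.carrier →
      pos ω b ∈ s.carrier → (between ω s a b).ncard ≤ t := fun hs ha hb =>
    G.between_le_of_level hk hs ha hb
  have b1 := lev (s := s₁) (a := .inr c₁) (b := .inr c₂) (by simp [hs₁, hU, hv.le]) m1' m2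
  have b2 := lev (s := s₂) (a := .inr c₂) (b := .inr c₃) (by simp [hs₂, hH]) m2' m3
  have b3 := lev (s := s₃) (a := .inr c₃) (b := .inr c₄) (by simp [hs₃, hH']) m3' m4
  have b4 := lev (s := s₄) (a := .inr c₄) (b := .inr c₅) (by simp [hs₄, hU', hv.le]) m4' m5
  have pop : ∀ {s : Street} {a b : Node n} {M : List (Fin n)},
      M.length ≤ (between ω s a b).ncard → ((M.length : ℝ) + 1) ≤ population ω s + 1 := by
    intro s a b M hM
    exact_mod_cast Nat.succ_le_succ (hM.trans (between_ncard_le_population ω s a b))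
  have en : ∀ {s : Street} {a b : Node n} {M : List (Fin n)}, s.level ≤ h →
      M.length ≤ (between ω s a b).ncard → ((M.length : ℝ) + 1) * power Pmax δ ω s ≤ Pmax / 5 :=
    fun hs hM => succ_mul_power_le_of_population hP hδ ω _ (G.le_population _ hs) (pop hM)
  have en0 := en (s := s₀) (by simp [hs₀, hA]) l0
  have en1 := succ_mul_power_le hP hδ ω s₁ (pop l1)
  have en2 := en (s := s₂) (by simp [hs₂, hH]) l2
  have en3 := en (s := s₃) (by simp [hs₃, hH']) l3
  have en4 := succ_mul_power_le hP hδ ω s₄ (pop l4)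
  have en5 := en (s := s₅) (by simp [hs₅, hB]) l5
  obtain ⟨hr, hh⟩ := ((((tr0.append tr1).append tr2).append tr3).append tr4 |>.append tr5).isRoute
    (s := s₅) trivial hj
  -- The final node is treated as a leg without intermediate nodes, so that the leg formulas apply
  -- to it.
  have hlast : ([(.inl j, s₅)] : List (Node n × Street)) = leg s₅ (.inl j) [] := rfl
  refine ⟨_, ⟨hr, hh, by simp, ?_⟩, ?_, ?_, ?_⟩
  · have hl := mul_power_le hP hδ ω s₅ (x := 1) (le_max_left _ _)
    rw [hlast]
    simp only [energy_append, energy_leg, List.length_nil]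
    push_cast
    linarith
  · apply nodup_of_nodup_filterMap
    · have hflat : ([i :: M₀, M₁, M₂, M₃, M₄, M₅ ++ [j]] : List (List (Fin n))).flatten.Nodup := by
        have on0' : ∀ m ∈ i :: M₀, ω.1 m ∈ s₀.carrier := by
          simpa using ⟨hi, on0⟩
        have on5' : ∀ m ∈ M₅ ++ [j], ω.1 m ∈ s₅.carrier := by
          intro m hm
          rcases List.mem_append.1 hm with hm | hm
          · exact on5 m hm
          · rw [List.mem_singleton.1 hm]; exact hj
        have hi0 : i ∉ M₀ := fun hm => notMem_uIoo_left (bt0 i hm).2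
        have hj5 : j ∉ M₅ := fun hm => notMem_uIoo_right (bt5 j hm).2
        simp only [List.nodup_cons, List.mem_cons, List.not_mem_nil, or_false, not_or] at hsne
        obtain ⟨⟨s01, s02, s03, s04, s05⟩, ⟨s12, s13, s14, s15⟩, ⟨s23, s24, s25⟩, ⟨s34, s35⟩,
          s45, -⟩ := hsne
        rw [List.nodup_flatten]
        refine ⟨?_, ?_⟩
        · intro l hl
          simp only [List.mem_cons, List.not_mem_nil, or_false] at hl
          rcases hl with rfl | rfl | rfl | rfl | rfl | rfl
          · exact List.nodup_cons.2 ⟨hi0, nd0⟩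
          · exact nd1
          · exact nd2
          · exact nd3
          · exact nd4
          · exact List.nodup_append.2 ⟨nd5, List.nodup_singleton _, by
              intro a ha b hb e
              rw [List.mem_singleton] at hb
              subst hb e
              exact hj5 ha⟩
        · simp only [List.pairwise_cons, List.mem_cons, List.not_mem_nil, or_false,
            forall_eq_or_imp, forall_eq, false_imp_iff, implies_true, List.Pairwise.nil, and_true]
          exact ⟨⟨G.disjoint_of_streets_ne s01 on0' on1, G.disjoint_of_streets_ne s02 on0' on2,
            G.disjoint_of_streets_ne s03 on0' on3, G.disjoint_of_streets_ne s04 on0' on4,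
            G.disjoint_of_streets_ne s05 on0' on5'⟩,
            ⟨G.disjoint_of_streets_ne s12 on1 on2, G.disjoint_of_streets_ne s13 on1 on3,
            G.disjoint_of_streets_ne s14 on1 on4, G.disjoint_of_streets_ne s15 on1 on5'⟩,
            ⟨G.disjoint_of_streets_ne s23 on2 on3, G.disjoint_of_streets_ne s24 on2 on4,
            G.disjoint_of_streets_ne s25 on2 on5'⟩,
            ⟨G.disjoint_of_streets_ne s34 on3 on4, G.disjoint_of_streets_ne s35 on3 on5'⟩,
            G.disjoint_of_streets_ne s45 on4 on5'⟩
      simp only [List.map_append, map_fst_leg, List.map_cons, List.map_nil, List.filterMap_append,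
        List.filterMap_cons, List.filterMap_nil, filterMap_getLeft_map_inl, Sum.getLeft?_inl,
        Sum.getLeft?_inr]
      simpa using hflat
    · simp only [List.map_append, map_fst_leg, List.map_cons, List.map_nil, List.filterMap_append,
        List.filterMap_cons, List.filterMap_nil, filterMap_getRight_map_inl, Sum.getRight?_inl,
        Sum.getRight?_inr]
      simpa using hcne
  · rw [hlast]
    simp only [relayCount_append, relayCount_leg]
    simp
  · rw [hlast]
    have : (leg s₀ (.inl i) M₀ ++ leg s₁ (.inr c₁) M₁ ++ leg s₂ (.inr c₂) M₂ ++
      leg s₃ (.inr c₃) M₃ ++ leg s₄ (.inr c₄) M₄ ++ leg s₅ (.inr c₅) M₅ ++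
      leg s₅ (.inl j) []).length ≤ 9 * (t + 1) + 1 := by
      simp only [List.length_append, length_leg, List.length_nil]
      omega
    exact_mod_cast this

end IsTypical

/-! ### The law of a mobile node -/

/-- A street is determined by its direction and its line. -/
def Street.equivDir : Bool × Line ≃ Street where
  toFun x := Street.ofDir x.1 x.2
  invFun s := match s with
    | .horizontal L => (true, L)
    | .vertical L => (false, L)
  left_inv x := by obtain ⟨d, L⟩ := x; cases d <;> rfl
  right_inv s := by cases s <;> rfl

instance : Countable Street := Street.equivDir.symm.injective.countable

instance : Countable Crossing :=
  Function.Injective.countable (f := fun c : Crossing => (c.col, c.row)) fun c c' h => by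
    cases c; cases c'; simp_all

theorem measurable_point (s : Street) : Measurable s.point := by
  cases s with
  | horizontal L => exact measurable_id.prodMk measurable_const
  | vertical L => exact measurable_const.prodMk measurable_id

theorem measurable_along (s : Street) : Measurable s.along := by
  cases s with
  | horizontal L => exact measurable_fst
  | vertical L => exact measurable_snd

/-- The points of the street `s` with abscissa in `I`. -/
def Street.segment (s : Street) (I : Set ℝ) : Set (ℝ × ℝ) := {z | z ∈ s.carrier ∧ s.along z ∈ I}

theorem measurableSet_segment (s : Street) {I : Set ℝ} (hI : MeasurableSet I) :
    MeasurableSet (s.segment I) := by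
  have h : s.segment I = ({z | s.point (s.along z) = z} ∩ s.along ⁻¹' Set.Icc 0 1) ∩
      s.along ⁻¹' I := by
    ext z
    simp [Street.segment, Street.mem_carrier]
  rw [h]
  have := measurable_along s
  have := measurable_point s
  exact ((measurableSet_eq_fun (by fun_prop) measurable_id).inter
    (measurable_along s measurableSet_Icc)).inter (measurable_along s hI)

theorem point_injective (s : Street) : Function.Injective s.point := by
  intro x y h
  cases s <;> simpa [Street.point] using h

theorem along_point (s : Street) (x : ℝ) : s.along (s.point x) = x := by
  cases s <;> rfl

theorem nodeLaw_apply (p : ℝ) {S : Set (ℝ × ℝ)} (hS : MeasurableSet S) :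
    nodeLaw p S = ∑' s : Street, ENNReal.ofReal (p / 2 * ((1 - p) / 2) ^ s.level) *
      volume (s.point ⁻¹' S ∩ Set.Icc 0 1) := by
  rw [nodeLaw, Measure.sum_apply _ hS]
  congr 1
  ext s
  rw [Measure.smul_apply, Measure.map_apply (measurable_point s) hS,
    Measure.restrict_apply (measurable_point s hS), smul_eq_mul]

theorem tsum_street_weight {p : ℝ} (hp : 0 < p ∧ p < 1) :
    ∑' s : Street, ENNReal.ofReal (p / 2 * ((1 - p) / 2) ^ s.level) = 1 := by
  rw [← Street.equivDir.tsum_eq, ENNReal.tsum_prod', tsum_bool]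
  have h : ∀ d : Bool, ∑' L : Line,
      ENNReal.ofReal (p / 2 * ((1 - p) / 2) ^ (Street.equivDir (d, L)).level) =
      ENNReal.ofReal (1 / 2) := by
    intro d
    rw [ENNReal.tsum_sigma']
    have h1 : ∀ l : ℕ, ∑' m : Fin (2 ^ l),
        ENNReal.ofReal (p / 2 * ((1 - p) / 2) ^ (Street.equivDir (d, ⟨l, m⟩)).level) =
        ENNReal.ofReal (p / 2 * (1 - p) ^ l) := by
      intro l
      have h2 : ∀ m : Fin (2 ^ l), (Street.equivDir (d, ⟨l, m⟩)).level = l := fun m =>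
        Street.level_ofDir d ⟨l, m⟩
      simp only [h2, tsum_fintype, Finset.sum_const, Finset.card_univ, Fintype.card_fin,
        nsmul_eq_mul]
      -- The 2^l streets of level l cancel the denominator of ((1 − p)/2)^l; each direction then has
      -- total mass 1/2 by a geometric series.
      rw [← ENNReal.ofReal_natCast, ← ENNReal.ofReal_mul (by positivity)]
      congr 1
      push_cast
      rw [div_pow]
      field_simp
    simp only [h1]
    have hg := (hasSum_geometric_of_lt_one (r := 1 - p) (by linarith) (by linarith)).mul_left
      (p / 2)
    rw [← ENNReal.ofReal_tsum_of_nonneg (fun l => by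
      have : 0 ≤ 1 - p := by linarith
      have := hp.1.le
      positivity) hg.summable, hg.tsum_eq]
    congr 1
    rw [sub_sub_cancel, div_mul_eq_mul_div, mul_inv_cancel₀ hp.1.ne']
  rw [h, h, ← ENNReal.ofReal_add (by norm_num) (by norm_num)]
  norm_num

theorem isProbabilityMeasure_nodeLaw {p : ℝ} (hp : 0 < p ∧ p < 1) :
    IsProbabilityMeasure (nodeLaw p) := by
  refine ⟨?_⟩
  rw [nodeLaw_apply p MeasurableSet.univ, ← tsum_street_weight hp]
  simp

theorem nodeLaw_singleton (p : ℝ) (z : ℝ × ℝ) : nodeLaw p {z} = 0 := by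
  rw [nodeLaw_apply p (measurableSet_singleton z), ENNReal.tsum_eq_zero]
  intro s
  have h : volume (s.point ⁻¹' {z} ∩ Set.Icc 0 1) = 0 := by
    refine Set.Subsingleton.measure_zero (fun x hx y hy => ?_) _
    exact point_injective s (hx.1.trans hy.1.symm)
  rw [h, mul_zero]

/-- Any other street meets `s` only in crossings, which are countably many and hence null. -/
theorem nodeLaw_segment (p : ℝ) (s : Street) {I : Set ℝ} (hI : MeasurableSet I)
    (hI1 : I ⊆ Set.Icc 0 1) :
    nodeLaw p (s.segment I) =
      ENNReal.ofReal (p / 2 * ((1 - p) / 2) ^ s.level) * volume I := by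
  rw [nodeLaw_apply p (measurableSet_segment s hI), tsum_eq_single s]
  · congr 2
    ext x
    simp only [Street.segment, Set.mem_inter_iff, Set.mem_preimage, Set.mem_ofPred_eq, along_point]
    exact ⟨fun h => h.1.2, fun h => ⟨⟨⟨x, hI1 h, rfl⟩, h⟩, hI1 h⟩⟩
  · intro s' hs'
    have h : volume (s'.point ⁻¹' s.segment I ∩ Set.Icc 0 1) = 0 := by
      have hsub : s'.point ⁻¹' s.segment I ∩ Set.Icc 0 1 ⊆
          s'.along '' Set.range Crossing.pos := by
        rintro x ⟨hx, hx'⟩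
        obtain ⟨c, hc⟩ := Street.eq_pos_of_mem_of_mem hs' ⟨x, hx', rfl⟩ hx.1
        exact ⟨_, ⟨c, hc.symm⟩, along_point s' x⟩
      exact measure_mono_null hsub (((Set.countable_range _).image _).measure_zero _)
    rw [h, mul_zero]

/-! ### Counting independent points -/

section Counting

theorem prod_one_add_indicator {X : Type*} {n : ℕ} (S : Set X) (x : Fin n → X) :
    ∏ i, (1 + S.indicator (1 : X → ℝ) (x i)) = 2 ^ {i | x i ∈ S}.ncard := by
  classical
  rw [Set.ncard_eq_toFinset_card', ← Finset.prod_const]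
  simp only [Set.toFinset_ofPred, Finset.prod_filter]
  refine Finset.prod_congr rfl fun i _ => ?_
  by_cases h : x i ∈ S <;> simp [h]
  norm_num

variable {X : Type*} [MeasurableSpace X] (μ : Measure X) [IsProbabilityMeasure μ]

/-- Markov's inequality for 2^N − 1, where N is the number of points in `S` and 2^N is a product of
independent factors. Subtracting 1 keeps a factor μ(S) in the bound, which makes it summable over
the infinitely many streets. -/
theorem pi_le_ncard_le (n : ℕ) {S : Set X} (hS : MeasurableSet S) {t : ℕ} (ht : 1 ≤ t) :
    Measure.pi (fun _ : Fin n => μ) {x | t ≤ {i | x i ∈ S}.ncard} ≤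
      ENNReal.ofReal (n * μ.real S * Real.exp (n * μ.real S) / (2 ^ t - 1)) := by
  set P := Measure.pi (fun _ : Fin n => μ)
  set m := μ.real S with hm
  have hm0 : 0 ≤ m := measureReal_nonneg
  have hind : Measurable (S.indicator (1 : X → ℝ)) := measurable_one.indicator hS
  set f : (Fin n → X) → ℝ := fun x => ∏ i, (1 + S.indicator (1 : X → ℝ) (x i)) with hf
  have hfm : Measurable f := by
    apply Finset.measurable_prod
    intro i _
    exact measurable_const.add (hind.comp (measurable_pi_apply i))
  have hf2 : ∀ x, f x = 2 ^ {i | x i ∈ S}.ncard := prod_one_add_indicator S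
  have hf1 : ∀ x, 1 ≤ f x := fun x => by rw [hf2]; exact one_le_pow₀ (by norm_num)
  have hfb : ∀ x, f x ≤ 2 ^ n := fun x => by
    rw [hf2]
    refine pow_le_pow_right₀ (by norm_num) ?_
    calc _ ≤ (Set.univ : Set (Fin n)).ncard := Set.ncard_le_ncard (Set.subset_univ _) (Set.toFinite _)
      _ = n := by simp [Set.ncard_univ]
  have hfi : Integrable f P := by
    refine Integrable.of_bound hfm.aestronglyMeasurable (2 ^ n) (ae_of_all _ fun x => ?_)
    rw [Real.norm_eq_abs, abs_of_nonneg (by linarith [hf1 x])]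
    exact hfb x
  have hint : ∫ x, f x ∂P = (1 + m) ^ n := by
    have h1 := integral_fintype_prod_eq_pow (ι := Fin n) (μ := μ)
      (fun y : X => (1 : ℝ) + S.indicator (1 : X → ℝ) y)
    have h2 : ∫ y, ((1 : ℝ) + S.indicator (1 : X → ℝ) y) ∂μ = 1 + m := by
      have h3 : Integrable (S.indicator (1 : X → ℝ)) μ := (integrable_const (1 : ℝ)).indicator hS
      rw [integral_add (integrable_const _) h3, integral_indicator_one hS]
      simp [hm]
    rw [h2, Fintype.card_fin] at h1
    exact h1
  have ht2 : (1 : ℝ) < 2 ^ t := one_lt_pow₀ (by norm_num) (by omega)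
  have hmk := mul_meas_ge_le_integral_of_nonneg (μ := P) (f := fun x => f x - 1)
    (ae_of_all _ fun x => sub_nonneg.2 (hf1 x)) (hfi.sub (integrable_const _)) (2 ^ t - 1)
  have hint' : ∫ x, (f x - 1) ∂P = (1 + m) ^ n - 1 := by
    rw [integral_sub hfi (integrable_const _), hint]
    simp
  rw [hint'] at hmk
  have hexp : (1 + m) ^ n - 1 ≤ n * m * Real.exp (n * m) := by
    have h1 : (1 + m) ^ n ≤ Real.exp (n * m) := by
      rw [Real.exp_nat_mul]
      exact pow_le_pow_left₀ (by linarith) (by linarith [Real.add_one_le_exp m]) n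
    -- With y = nm this says exp y − 1 ≤ y·exp y.
    have h2 : Real.exp (n * m) * (1 - n * m) ≤ 1 := by
      have := Real.add_one_le_exp (-(n * m))
      calc Real.exp (n * m) * (1 - n * m) ≤ Real.exp (n * m) * Real.exp (-(n * m)) := by
            gcongr; linarith
        _ = 1 := by rw [← Real.exp_add]; simp
    nlinarith
  have hset : {x : Fin n → X | t ≤ {i | x i ∈ S}.ncard} ⊆ {x | 2 ^ t - 1 ≤ f x - 1} := by
    intro x hx
    simp only [Set.mem_ofPred_eq] at hx ⊢
    rw [hf2]
    have : (2 : ℝ) ^ t ≤ 2 ^ {i | x i ∈ S}.ncard := pow_le_pow_right₀ (by norm_num) hx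
    linarith
  refine (measure_mono hset).trans ?_
  rw [← ofReal_measureReal]
  apply ENNReal.ofReal_le_ofReal
  rw [le_div_iff₀ (by linarith), mul_comm]
  exact hmk.trans hexp

theorem pi_forall_notMem_le (n : ℕ) {S : Set X} (hS : MeasurableSet S) :
    Measure.pi (fun _ : Fin n => μ) {x | ∀ i, x i ∉ S} ≤
      ENNReal.ofReal (Real.exp (-(n * μ.real S))) := by
  have h : {x : Fin n → X | ∀ i, x i ∉ S} = Set.univ.pi fun _ => Sᶜ := by
    ext x; simp
  rw [h, Measure.pi_pi, Finset.prod_const, Finset.card_univ, Fintype.card_fin,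
    ← ofReal_measureReal, probReal_compl_eq_one_sub hS, ← ENNReal.ofReal_pow (by
      linarith [measureReal_le_one (μ := μ) (s := S)])]
  apply ENNReal.ofReal_le_ofReal
  rw [← mul_neg, Real.exp_nat_mul]
  refine pow_le_pow_left₀ (by linarith [measureReal_le_one (μ := μ) (s := S)]) ?_ n
  linarith [Real.add_one_le_exp (-(μ.real S))]

end Counting

/-! ### Probabilities of events of the hyperfractal -/

theorem hyperfractalLaw_fst {p : ℝ} (hp : 0 < p ∧ p < 1) (pr : ℝ) (n : ℕ)
    (A : Set (Fin n → ℝ × ℝ)) :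
    hyperfractalLaw p pr n {ω | ω.1 ∈ A} = Measure.pi (fun _ : Fin n => nodeLaw p) A := by
  have := isProbabilityMeasure_nodeLaw hp
  have h : {ω : Config n | ω.1 ∈ A} = A ×ˢ Set.univ := by ext; simp
  rw [hyperfractalLaw, h, Measure.prod_prod, measure_univ, mul_one]

theorem hyperfractalLaw_snd {p : ℝ} (hp : 0 < p ∧ p < 1) (pr : ℝ) (n : ℕ)
    (A : Set (Crossing → ℕ)) :
    hyperfractalLaw p pr n {ω | ω.2 ∈ A} = Measure.infinitePi
      (fun c : Crossing => poissonMeasure (relayIntensity pr n c).toNNReal) A := by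
  have := isProbabilityMeasure_nodeLaw hp
  have h : {ω : Config n | ω.2 ∈ A} = Set.univ ×ˢ A := by ext; simp
  rw [hyperfractalLaw, h, Measure.prod_prod, measure_univ, one_mul]

/-- Two streets share at most a crossing; there are countably many crossings, and the law of a
mobile node has no atoms. -/
theorem hyperfractalLaw_two_streets {p : ℝ} (hp : 0 < p ∧ p < 1) (pr : ℝ) (n : ℕ) :
    hyperfractalLaw p pr n {ω | ∃ (i : Fin n) (s s' : Street),
      ω.1 i ∈ s.carrier ∧ ω.1 i ∈ s'.carrier ∧ s ≠ s'} = 0 := by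
  have := isProbabilityMeasure_nodeLaw hp
  have hsub : {ω : Config n | ∃ (i : Fin n) (s s' : Street),
      ω.1 i ∈ s.carrier ∧ ω.1 i ∈ s'.carrier ∧ s ≠ s'} ⊆
      ⋃ (i : Fin n) (c : Crossing), {ω | ω.1 ∈ (fun x => x i) ⁻¹' {c.pos}} := by
    rintro ω ⟨i, s, s', h, h', hne⟩
    obtain ⟨c, hc⟩ := Street.eq_pos_of_mem_of_mem hne h h'
    exact Set.mem_iUnion₂.2 ⟨i, c, hc⟩
  refine measure_mono_null hsub (measure_iUnion_null fun i => measure_iUnion_null fun c => ?_)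
  rw [hyperfractalLaw_fst hp, (measurePreserving_eval (fun _ : Fin n => nodeLaw p) i).measure_preimage
    (measurableSet_singleton _).nullMeasurableSet]
  exact nodeLaw_singleton p _

theorem hyperfractalLaw_relays_absent_le {p : ℝ} (hp : 0 < p ∧ p < 1) (pr : ℝ) (n : ℕ)
    (F : Finset Crossing) {r : ℝ} (hr : ∀ c ∈ F, r ≤ relayIntensity pr n c) :
    hyperfractalLaw p pr n {ω | ∀ c ∈ F, ω.2 c = 0} ≤
      ENNReal.ofReal (Real.exp (-(F.card * r))) := by
  have h : {ω : Config n | ∀ c ∈ F, ω.2 c = 0} =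
      {ω | ω.2 ∈ Set.pi (F : Set Crossing) fun _ => {0}} := by
    ext; simp
  rw [h, hyperfractalLaw_snd hp, Measure.infinitePi_pi _ (by simp)]
  calc ∏ c ∈ F, poissonMeasure (relayIntensity pr n c).toNNReal {0}
      ≤ ∏ c ∈ F, ENNReal.ofReal (Real.exp (-r)) := by
        refine Finset.prod_le_prod' fun c hc => ?_
        rw [poissonMeasure_singleton]
        apply ENNReal.ofReal_le_ofReal
        have := hr c hc
        simp only [pow_zero, mul_one, Nat.factorial_zero, Nat.cast_one, div_one]
        apply Real.exp_le_exp.2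
        have := Real.le_coe_toNNReal (relayIntensity pr n c)
        linarith
    _ = ENNReal.ofReal (Real.exp (-(F.card * r))) := by
        rw [Finset.prod_const, ← ENNReal.ofReal_pow (Real.exp_pos _).le, ← mul_neg,
          Real.exp_nat_mul]

theorem relayIntensity_crossingOf (pr ρ : ℝ) (d : Bool) (L L' : Line) :
    relayIntensity pr ρ (crossingOf d L L') = ρ * pr ^ 2 * ((1 - pr) / 2) ^ (L.1 + L'.1) := by
  cases d
  · rw [add_comm]; rfl
  · rfl

/-- The cell contains 2^(l − k) crossings with streets of level `l`, whose Poisson counts are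
independent with the same mean; all of them must vanish. -/
theorem hyperfractalLaw_not_relayInCell_le {p : ℝ} (hp : 0 < p ∧ p < 1) (pr : ℝ) (n : ℕ)
    (d : Bool) (L : Line) {l k j : ℕ} (hk : k ≤ l) (hj : j < 2 ^ k) :
    hyperfractalLaw p pr n {ω | ¬ RelayInCell ω d L l k j} ≤
      ENNReal.ofReal (Real.exp
        (-(2 ^ (l - k) * (n * pr ^ 2 * ((1 - pr) / 2) ^ (L.1 + l))))) := by
  classical
  have hm : ∀ r : Fin (2 ^ (l - k)), j * 2 ^ (l - k) + r < 2 ^ l := by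
    intro r
    calc j * 2 ^ (l - k) + r < (j + 1) * 2 ^ (l - k) := by
          have := r.2
          rw [add_mul]; omega
      _ ≤ 2 ^ k * 2 ^ (l - k) := Nat.mul_le_mul_right _ hj
      _ = 2 ^ l := by rw [← pow_add]; congr 1; omega
  let φ : Fin (2 ^ (l - k)) → Crossing := fun r => crossingOf d L ⟨l, ⟨j * 2 ^ (l - k) + r, hm r⟩⟩
  have hφ : Function.Injective φ := by
    intro r r' h
    have := (crossingOf_injective h).2
    simp only [Sigma.mk.injEq, heq_eq_eq, Fin.mk.injEq, true_and] at this
    exact Fin.ext (by omega)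
  have h := hyperfractalLaw_relays_absent_le hp pr n (Finset.univ.image φ)
    (r := n * pr ^ 2 * ((1 - pr) / 2) ^ (L.1 + l)) (by
      intro c hc
      obtain ⟨r, -, rfl⟩ := Finset.mem_image.1 hc
      exact (relayIntensity_crossingOf pr n d L ⟨l, ⟨_, hm r⟩⟩).ge)
  rw [Finset.card_image_of_injective _ hφ, Finset.card_univ, Fintype.card_fin] at h
  push_cast at h
  refine (measure_mono ?_).trans h
  intro ω hω c hc
  obtain ⟨r, -, rfl⟩ := Finset.mem_image.1 hc
  by_contra hne
  exact hω ⟨_, rfl, coord_mem_dyadicCell hk r.2 (hm r), Nat.one_le_iff_ne_zero.2 hne⟩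

/-! ### Typical configurations have high probability -/

theorem measure_exists_street_le {Ω : Type*} [MeasurableSpace Ω] (μ : Measure Ω)
    (P : Bool → Line → Ω → Prop) (h : ℕ) {ε : ℝ≥0∞}
    (hP : ∀ d L, L.1 ≤ h → μ {ω | P d L ω} ≤ ε) :
    μ {ω | ∃ d L, L.1 ≤ h ∧ P d L ω} ≤ (4 * 2 ^ h : ℕ) * ε := by
  have hsub : {ω | ∃ d L, L.1 ≤ h ∧ P d L ω} ⊆
      ⋃ d : Bool, ⋃ l ∈ Finset.range (h + 1), ⋃ m : Fin (2 ^ l), {ω | P d ⟨l, m⟩ ω} := by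
    rintro ω ⟨d, ⟨l, m⟩, hl, hω⟩
    simp only [Set.mem_iUnion]
    exact ⟨d, l, Finset.mem_range.2 (Nat.lt_succ_of_le hl), m, hω⟩
  have hgeom : ∀ h : ℕ, ∑ l ∈ Finset.range (h + 1), 2 ^ l ≤ 2 * 2 ^ h := by
    intro h
    induction h with
    | zero => simp
    | succ h ih => rw [Finset.sum_range_succ, pow_succ]; omega
  refine (measure_mono hsub).trans ((measure_iUnion_fintype_le μ _).trans ?_)
  calc ∑ d : Bool, μ (⋃ l ∈ Finset.range (h + 1), ⋃ m : Fin (2 ^ l), {ω | P d ⟨l, m⟩ ω})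
      ≤ ∑ d : Bool, ((2 * 2 ^ h : ℕ) : ℝ≥0∞) * ε := by
        refine Finset.sum_le_sum fun d _ => (measure_biUnion_finset_le _ _).trans ?_
        calc ∑ l ∈ Finset.range (h + 1), μ (⋃ m : Fin (2 ^ l), {ω | P d ⟨l, m⟩ ω})
            ≤ ∑ l ∈ Finset.range (h + 1), ((2 ^ l : ℕ) : ℝ≥0∞) * ε := by
              refine Finset.sum_le_sum fun l hl => (measure_iUnion_fintype_le μ _).trans ?_
              refine (Finset.sum_le_sum fun m _ => hP d ⟨l, m⟩
                (Nat.lt_succ_iff.1 (Finset.mem_range.1 hl))).trans ?_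
              simp
          _ = ((∑ l ∈ Finset.range (h + 1), 2 ^ l : ℕ) : ℝ≥0∞) * ε := by
              rw [← Finset.sum_mul, Nat.cast_sum]
          _ ≤ _ := by
              gcongr
              exact hgeom h
    _ = (4 * 2 ^ h : ℕ) * ε := by
        simp only [Finset.sum_const, Finset.card_univ, Fintype.card_bool, nsmul_eq_mul]
        push_cast
        ring

theorem measure_exists_lt_le {Ω : Type*} [MeasurableSpace Ω] (μ : Measure Ω)
    (P : ℕ → Ω → Prop) (N : ℕ) {ε : ℝ≥0∞} (hP : ∀ j < N, μ {ω | P j ω} ≤ ε) :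
    μ {ω | ∃ j < N, P j ω} ≤ N * ε := by
  have hsub : {ω | ∃ j < N, P j ω} ⊆ ⋃ j ∈ Finset.range N, {ω | P j ω} := by
    rintro ω ⟨j, hj, hω⟩
    exact Set.mem_iUnion₂.2 ⟨j, Finset.mem_range.2 hj, hω⟩
  refine (measure_mono hsub).trans ((measure_biUnion_finset_le _ _).trans ?_)
  refine (Finset.sum_le_sum fun j hj => hP j (Finset.mem_range.1 hj)).trans ?_
  simp

theorem measurableSet_dyadicCell (k j : ℕ) : MeasurableSet (dyadicCell k j) := measurableSet_Icc

theorem volume_dyadicCell (k j : ℕ) : volume (dyadicCell k j) = ENNReal.ofReal (1 / 2 ^ k) := by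
  rw [dyadicCell, Real.volume_Icc]
  congr 1
  ring

/-- The bound for one cell is proportional to its mass before the factor n. The cells of a street
add up to the weight of the street, and the weights of all streets add up to 1, so the union bound
over infinitely many streets costs nothing. -/
theorem hyperfractalLaw_exists_crowded_cell_le {p : ℝ} (hp : 0 < p ∧ p < 1) (pr : ℝ) (n : ℕ)
    (k : ℕ → ℕ) {t : ℕ} (ht : 1 ≤ t) {B : ℝ}
    (hB : ∀ l, n * (((1 - p) / 2) ^ l / 2 ^ k l) ≤ B) :
    hyperfractalLaw p pr n {ω | ∃ s : Street, ∃ j < 2 ^ k s.level,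
      t < (nodesInCell ω s (k s.level) j).ncard} ≤
      ENNReal.ofReal (n * Real.exp B / (2 ^ t - 1)) := by
  have := isProbabilityMeasure_nodeLaw hp
  have ht2 : (1 : ℝ) < 2 ^ t := one_lt_pow₀ (by norm_num) (by omega)
  have hq : 0 < (1 - p) / 2 := by linarith
  set K : ℝ := n * Real.exp B / (2 ^ t - 1) with hK
  have hK0 : 0 ≤ K := div_nonneg (by positivity) (by linarith)
  set w : Street → ℝ := fun s => p / 2 * ((1 - p) / 2) ^ s.level with hw
  have hw0 : ∀ s, 0 ≤ w s := fun s => by have := hp.1.le; positivity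
  have hcell : ∀ (s : Street), ∀ j < 2 ^ k s.level, hyperfractalLaw p pr n
      {ω | t < (nodesInCell ω s (k s.level) j).ncard} ≤
      ENNReal.ofReal (K * (w s / 2 ^ k s.level)) := by
    intro s j hj
    have hm : (nodeLaw p).real (s.segment (dyadicCell (k s.level) j)) = w s / 2 ^ k s.level := by
      rw [measureReal_def, nodeLaw_segment p s (measurableSet_dyadicCell _ _) (dyadicCell_subset hj),
        volume_dyadicCell, ← ENNReal.ofReal_mul (hw0 s), ENNReal.toReal_ofReal (by
          have := hw0 s; positivity)]
      ring
    have hle := pi_le_ncard_le (nodeLaw p) n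
      (measurableSet_segment s (measurableSet_dyadicCell (k s.level) j)) ht
    rw [hm] at hle
    rw [← hyperfractalLaw_fst hp pr] at hle
    have hmono : {ω : Config n | t < (nodesInCell ω s (k s.level) j).ncard} ⊆ {ω | ω.1 ∈
        {x : Fin n → ℝ × ℝ | t ≤ {i | x i ∈ s.segment (dyadicCell (k s.level) j)}.ncard}} :=
      fun ω hω => show t ≤ _ from le_of_lt (show t < _ from hω)
    refine (measure_mono hmono).trans (hle.trans (ENNReal.ofReal_le_ofReal ?_))
    have h1 : n * (w s / 2 ^ k s.level) ≤ B := by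
      refine le_trans ?_ (hB s.level)
      gcongr
      have h2 : 0 ≤ ((1 - p) / 2) ^ s.level := by positivity
      simp only [hw]
      nlinarith [hp.2]
    have h0 := hw0 s
    calc n * (w s / 2 ^ k s.level) * Real.exp (n * (w s / 2 ^ k s.level)) / (2 ^ t - 1)
        ≤ n * (w s / 2 ^ k s.level) * Real.exp B / (2 ^ t - 1) := by
          have : (0 : ℝ) ≤ 2 ^ t - 1 := by linarith
          gcongr
      _ = K * (w s / 2 ^ k s.level) := by rw [hK]; ring
  calc hyperfractalLaw p pr n {ω | ∃ s : Street, ∃ j < 2 ^ k s.level,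
        t < (nodesInCell ω s (k s.level) j).ncard}
      ≤ ∑' s : Street, hyperfractalLaw p pr n {ω | ∃ j < 2 ^ k s.level,
        t < (nodesInCell ω s (k s.level) j).ncard} := by
        refine (measure_mono fun ω hω => ?_).trans (measure_iUnion_le _)
        exact Set.mem_iUnion.2 hω
    _ ≤ ∑' s : Street, ENNReal.ofReal K * ENNReal.ofReal (w s) := by
        refine ENNReal.tsum_le_tsum fun s => ?_
        refine (measure_exists_lt_le _ (fun j ω => t < (nodesInCell ω s (k s.level) j).ncard) _
          (hcell s)).trans (le_of_eq ?_)
        rw [← ENNReal.ofReal_natCast, ← ENNReal.ofReal_mul (by positivity), ← ENNReal.ofReal_mul hK0]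
        congr 1
        push_cast
        field_simp
    _ = ENNReal.ofReal K := by
        rw [ENNReal.tsum_mul_left, tsum_street_weight hp, mul_one]

/-- If each of ten disjoint tenths of the street is occupied, there are ten distinct nodes. The
half-open intervals make the tenths disjoint. -/
theorem hyperfractalLaw_population_lt_le {p : ℝ} (hp : 0 < p ∧ p < 1) (pr : ℝ) (n : ℕ)
    (s : Street) :
    hyperfractalLaw p pr n {ω | population ω s < 10} ≤
      10 * ENNReal.ofReal (Real.exp (-(n * (p / 2 * ((1 - p) / 2) ^ s.level) / 10))) := by
  have := isProbabilityMeasure_nodeLaw hp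
  have hw0 : 0 ≤ p / 2 * ((1 - p) / 2) ^ s.level := by
    have := hp.1.le
    have : 0 ≤ 1 - p := by linarith [hp.2]
    positivity
  let I : ℕ → Set ℝ := fun j => Set.Ico ((j : ℝ) / 10) ((j + 1) / 10)
  have hIm : ∀ j, MeasurableSet (I j) := fun j => measurableSet_Ico
  have hcell : ∀ j < 10, hyperfractalLaw p pr n {ω | ∀ i, ω.1 i ∉ s.segment (I j)} ≤
      ENNReal.ofReal (Real.exp (-(n * (p / 2 * ((1 - p) / 2) ^ s.level) / 10))) := by
    intro j hj
    have hj' : (j : ℝ) + 1 ≤ 10 := by exact_mod_cast hj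
    have hsub : I j ⊆ Set.Icc 0 1 := by
      rintro x ⟨h1, h2⟩
      have : (0 : ℝ) ≤ (j : ℝ) / 10 := by positivity
      exact ⟨by linarith, by linarith⟩
    have hm : (nodeLaw p).real (s.segment (I j)) = p / 2 * ((1 - p) / 2) ^ s.level / 10 := by
      rw [measureReal_def, nodeLaw_segment p s (hIm j) hsub, Real.volume_Ico,
        ← ENNReal.ofReal_mul hw0, show ((j : ℝ) + 1) / 10 - j / 10 = 1 / 10 by ring,
        ENNReal.toReal_ofReal (by positivity)]
      ring
    have hle := pi_forall_notMem_le (nodeLaw p) n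
      (measurableSet_segment s (hIm j))
    rw [hm, ← hyperfractalLaw_fst hp pr, ← mul_div_assoc] at hle
    exact hle
  have h := measure_exists_lt_le (hyperfractalLaw p pr n)
    (fun j ω => ∀ i, ω.1 i ∉ s.segment (I j)) 10 hcell
  refine (measure_mono ?_).trans h
  intro ω hω
  by_contra hcon
  simp only [Set.mem_ofPred_eq, not_exists, not_and, not_forall, not_not] at hcon hω
  have : Nonempty (Fin n) := ⟨(hcon 0 (by norm_num)).choose⟩
  choose! φ hφ using hcon
  have hinj : Set.InjOn φ (Finset.range 10 : Set ℕ) := by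
    intro a ha b hb hab
    have h1 := (hφ a (by simpa using ha)).2
    have h2 := (hφ b (by simpa using hb)).2
    rw [hab] at h1
    have h3 : (a : ℝ) < b + 1 := by linarith [h1.1, h2.2]
    have h4 : (b : ℝ) < a + 1 := by linarith [h2.1, h1.2]
    have h5 : a < b + 1 := by exact_mod_cast h3
    have h6 : b < a + 1 := by exact_mod_cast h4
    omega
  have hcard : (φ '' (Finset.range 10 : Set ℕ)).ncard = 10 := by
    rw [hinj.ncard_image, Set.ncard_coe_finset, Finset.card_range]
  have hle : (φ '' (Finset.range 10 : Set ℕ)).ncard ≤ population ω s := by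
    refine Set.ncard_le_ncard ?_ (Set.toFinite _)
    rintro i ⟨j, hj, rfl⟩
    exact (hφ j (by simpa using hj)).1
  omega

theorem eq_of_coord_mem_dyadicCell {l : ℕ} {m m' : Fin (2 ^ l)}
    (h : Line.coord ⟨l, m'⟩ ∈ dyadicCell l m) : m' = m := by
  simp only [Line.coord, dyadicCell, Set.mem_Icc, pow_succ] at h
  have h2 : (0 : ℝ) < 2 ^ l := by positivity
  obtain ⟨h1, h3⟩ := h
  rw [div_le_div_iff₀ h2 (by positivity)] at h1
  rw [div_le_div_iff₀ (by positivity) h2] at h3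
  have h4 : ((m : ℕ) : ℝ) * 2 ≤ 2 * (m' : ℕ) + 1 :=
    le_of_mul_le_mul_right (by linarith) h2
  have h5 : 2 * ((m' : ℕ) : ℝ) + 1 ≤ ((m : ℕ) + 1) * 2 :=
    le_of_mul_le_mul_right (by linarith) h2
  have h6 : (m : ℕ) * 2 ≤ 2 * (m' : ℕ) + 1 := by exact_mod_cast h4
  have h7 : 2 * (m' : ℕ) + 1 ≤ ((m : ℕ) + 1) * 2 := by exact_mod_cast h5
  exact Fin.ext (by omega)

/-- A union bound over the failing conditions. The relay terms contribute 4 + 8 + 4 = 16 times 4^v,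
and 40·2^v is ten tenths for each of at most 4·2^h streets. Only monotonicity and subadditivity are
used on the exceptional set, so its measurability is not needed. -/
theorem hyperfractalLaw_not_isTypical_le {p pr : ℝ} (hp : 0 < p ∧ p < 1)
    (n : ℕ) {h v t : ℕ} {k : ℕ → ℕ} (h0 : 0 < h) (hv : h ≤ v) (hk : ∀ l ≤ h, k l ≤ v)
    (ht : 1 ≤ t) {B r : ℝ} (hB : ∀ l, n * (((1 - p) / 2) ^ l / 2 ^ k l) ≤ B)
    (hr1 : ∀ l ≤ h, r ≤ 2 ^ (v - k l) * (n * pr ^ 2 * ((1 - pr) / 2) ^ (l + v)))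
    (hr2 : r ≤ 2 ^ (h - 1) * (n * pr ^ 2 * ((1 - pr) / 2) ^ (v + h)))
    (hr3 : r ≤ n * pr ^ 2 * ((1 - pr) / 2) ^ (h + h)) :
    hyperfractalLaw p pr n {ω | ¬ IsTypical ω h v t k} ≤
      ENNReal.ofReal (n * Real.exp B / (2 ^ t - 1)) +
      (40 * 2 ^ v : ℕ) *
        ENNReal.ofReal (Real.exp (-(n * (p / 2 * ((1 - p) / 2) ^ h) / 10))) +
      (16 * 4 ^ v : ℕ) * ENNReal.ofReal (Real.exp (-r)) := by
  set μ := hyperfractalLaw p pr n with hμ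
  set ε := ENNReal.ofReal (Real.exp (-r)) with hε
  set ε' := ENNReal.ofReal (Real.exp (-(n * (p / 2 * ((1 - p) / 2) ^ h) / 10))) with hε'
  have p2 : ∀ {a b : ℕ}, a ≤ b → 2 ^ a ≤ 2 ^ b := fun h => Nat.pow_le_pow_right (by norm_num) h
  have p4 : 4 ^ v = 2 ^ v * 2 ^ v := by rw [← mul_pow]; norm_num
  have a1 := hyperfractalLaw_two_streets hp pr n
  have a2 := hyperfractalLaw_exists_crowded_cell_le hp pr n k ht hB
  have a3 : μ {ω | ∃ d L, L.1 ≤ h ∧ population ω (Street.ofDir d L) < 10} ≤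
      (40 * 2 ^ v : ℕ) * ε' := by
    refine (measure_exists_street_le μ _ h (ε := 10 * ε') fun d L hL => ?_).trans ?_
    · refine (hyperfractalLaw_population_lt_le hp pr n (Street.ofDir d L)).trans ?_
      rw [Street.level_ofDir, hε']
      have hq : 0 ≤ (1 - p) / 2 := by linarith [hp.2]
      have hpow : ((1 - p) / 2) ^ h ≤ ((1 - p) / 2) ^ L.1 :=
        pow_le_pow_of_le_one hq (by linarith [hp.1]) hL
      have hp0 := hp.1.le
      gcongr
    · rw [← mul_assoc]
      gcongr
      have := p2 hv
      exact_mod_cast (show 4 * 2 ^ h * 10 ≤ 40 * 2 ^ v by omega)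
  have a4 : μ {ω | ∃ d L, L.1 ≤ h ∧ ∃ j < 2 ^ k L.1, ¬ RelayInCell ω d L v (k L.1) j} ≤
      (4 * 4 ^ v : ℕ) * ε := by
    refine (measure_exists_street_le μ _ h (ε := (2 ^ v : ℕ) * ε) fun d L hL => ?_).trans ?_
    · refine (measure_exists_lt_le μ _ _ fun j hj => hyperfractalLaw_not_relayInCell_le hp pr n d L
        (hk _ hL) hj).trans ?_
      refine mul_le_mul' (by exact_mod_cast p2 (hk _ hL)) (ENNReal.ofReal_le_ofReal
        (Real.exp_le_exp.2 (neg_le_neg (hr1 _ hL))))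
    · rw [← mul_assoc]
      gcongr
      have := p2 hv
      exact_mod_cast (show 4 * 2 ^ h * 2 ^ v ≤ 4 * 4 ^ v by rw [p4, ← mul_assoc]; gcongr)
  have a5 : μ {ω | ∃ d L, L.1 ≤ v ∧ L.1 = v ∧ ∃ j < 2, ¬ RelayInCell ω d L h 1 j} ≤
      (8 * 4 ^ v : ℕ) * ε := by
    refine (measure_exists_street_le μ _ v (ε := (2 : ℕ) * ε) fun d L hL => ?_).trans ?_
    · by_cases hLv : L.1 = v
      · simp only [hLv, true_and]
        refine (measure_exists_lt_le μ _ _ fun j hj => hyperfractalLaw_not_relayInCell_le hp pr n d L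
          (Nat.one_le_iff_ne_zero.2 h0.ne') (by simpa using hj)).trans ?_
        rw [hLv]
        exact mul_le_mul' le_rfl (ENNReal.ofReal_le_ofReal
          (Real.exp_le_exp.2 (neg_le_neg hr2)))
      · simp [hLv]
    · rw [← mul_assoc]
      gcongr
      have h1 : 1 ≤ 2 ^ v := Nat.one_le_two_pow
      exact_mod_cast (show 4 * 2 ^ v * 2 ≤ 8 * 4 ^ v by rw [p4]; nlinarith)
  -- A cell of length 2^(−h) contains exactly one line of level `h`, so relays in all these cells
  -- mean relays at all crossings of two streets of level `h`.
  have a6 : μ {ω | ∃ d L, L.1 ≤ h ∧ L.1 = h ∧ ∃ j < 2 ^ h, ¬ RelayInCell ω d L h h j} ≤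
      (4 * 4 ^ v : ℕ) * ε := by
    refine (measure_exists_street_le μ _ h (ε := (2 ^ h : ℕ) * ε) fun d L hL => ?_).trans ?_
    · by_cases hLh : L.1 = h
      · simp only [hLh, true_and]
        refine (measure_exists_lt_le μ _ _ fun j hj => hyperfractalLaw_not_relayInCell_le hp pr n d L
          le_rfl hj).trans ?_
        rw [hLh, Nat.sub_self, pow_zero, one_mul]
        exact mul_le_mul' le_rfl (ENNReal.ofReal_le_ofReal
          (Real.exp_le_exp.2 (neg_le_neg hr3)))
      · simp [hLh]
    · rw [← mul_assoc]
      gcongr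
      have := p2 hv
      exact_mod_cast (show 4 * 2 ^ h * 2 ^ h ≤ 4 * 4 ^ v by rw [p4, ← mul_assoc]; gcongr)
  have hsub : {ω : Config n | ¬ IsTypical ω h v t k} ⊆
      ((((({ω | ∃ (i : Fin n) (s s' : Street), ω.1 i ∈ s.carrier ∧ ω.1 i ∈ s'.carrier ∧ s ≠ s'} ∪
      {ω | ∃ s : Street, ∃ j < 2 ^ k s.level, t < (nodesInCell ω s (k s.level) j).ncard}) ∪
      {ω | ∃ d L, L.1 ≤ h ∧ population ω (Street.ofDir d L) < 10}) ∪
      {ω | ∃ d L, L.1 ≤ h ∧ ∃ j < 2 ^ k L.1, ¬ RelayInCell ω d L v (k L.1) j}) ∪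
      {ω | ∃ d L, L.1 ≤ v ∧ L.1 = v ∧ ∃ j < 2, ¬ RelayInCell ω d L h 1 j}) ∪
      {ω | ∃ d L, L.1 ≤ h ∧ L.1 = h ∧ ∃ j < 2 ^ h, ¬ RelayInCell ω d L h h j}) := by
    intro ω hω
    by_contra hcon
    simp only [Set.mem_union, Set.mem_ofPred_eq, not_or, not_exists, not_and, not_not, not_lt]
      at hcon
    obtain ⟨⟨⟨⟨⟨c1, c2⟩, c3⟩, c4⟩, c5⟩, c6⟩ := hcon
    refine hω ⟨c1, c2, ?_, c4, fun d L hL => c5 d L hL.le hL, ?_⟩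
    · intro s hs
      obtain ⟨d, L, rfl⟩ := s.exists_ofDir
      exact c3 d L (by simpa using hs)
    · rintro d L ⟨l', m⟩ hL hL'
      simp only at hL'
      subst hL'
      obtain ⟨⟨l'', m'⟩, e, hm, hrel⟩ := c6 d L hL.le hL m m.2
      simp only at e
      subst e
      rwa [eq_of_coord_mem_dyadicCell hm] at hrel
  refine (measure_mono hsub).trans ?_
  refine (measure_union_le _ _).trans ((add_le_add ((measure_union_le _ _).trans
    (add_le_add ((measure_union_le _ _).trans (add_le_add ((measure_union_le _ _).trans
    (add_le_add ((measure_union_le _ _).trans (add_le_add a1.le a2)) a3)) a4)) a5)) a6).trans ?_)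
  apply le_of_eq
  push_cast
  ring

/-! ### Choice of the levels -/

/-- The three inequalities bound below the binary logarithms of expected relay numbers, up to
constant factors: in a cell, in half a street of level `v`, and at a crossing of two streets of
level `h`. Without rounding, the coefficients of x are at least 1 − Dβ, 1 − Dβ − (D − 1)β/A and 1 −
2Dβ/A. All three are positive for this β; κ is their minimum, and K = A + 2D absorbs the ceilings.
-/
theorem exists_exponent {A D β : ℝ} (hA : 2 < A) (hD : 1 < D) (hDA : 2 * D < A)
    (hβ : β = (A + 1) / (D * (A + 2))) :
    ∃ κ > 0, ∃ K : ℝ, ∀ x : ℝ, 0 ≤ x → ∀ h v : ℕ, ∀ k : ℕ → ℕ,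
      h = ⌈β * x / A⌉₊ → v = ⌈β * x⌉₊ → (∀ l : ℕ, k l = ⌈β * x - A * l⌉₊) → 0 < h →
      (∀ l ≤ h, κ * x - K ≤ ((v - k l : ℕ) : ℝ) + x - D * (l + v)) ∧
      κ * x - K ≤ ((h - 1 : ℕ) : ℝ) + x - D * (v + h) ∧ κ * x - K ≤ x - D * (h + h) := by
  have hA0 : 0 < A := by linarith
  have hD0 : 0 < D := by linarith
  have hβ0 : 0 < β := by rw [hβ]; positivity
  have e1 : 1 - D * β = 1 / (A + 2) := by rw [hβ]; field_simp; ring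
  have e2 : 1 - D * β - (D - 1) * (β / A) = (A + 1 - D) / (D * A * (A + 2)) := by
    rw [hβ]; field_simp; ring
  have e3 : 1 - 2 * D * (β / A) = (A ^ 2 - 2) / (A * (A + 2)) := by rw [hβ]; field_simp; ring
  have k1 : 0 < 1 - D * β := by rw [e1]; positivity
  have k2 : 0 < 1 - D * β - (D - 1) * (β / A) := by
    rw [e2]
    exact div_pos (by linarith) (by positivity)
  have k3 : 0 < 1 - 2 * D * (β / A) := by
    rw [e3]
    exact div_pos (by nlinarith) (by positivity)
  refine ⟨min (1 - D * β) (min (1 - D * β - (D - 1) * (β / A)) (1 - 2 * D * (β / A))),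
    lt_min k1 (lt_min k2 k3), A + 2 * D, ?_⟩
  intro x hx h v k hh hv hk h0
  set κ := min (1 - D * β) (min (1 - D * β - (D - 1) * (β / A)) (1 - 2 * D * (β / A))) with hκ
  have m1 : κ * x ≤ (1 - D * β) * x := mul_le_mul_of_nonneg_right (min_le_left _ _) hx
  have m2 : κ * x ≤ (1 - D * β - (D - 1) * (β / A)) * x :=
    mul_le_mul_of_nonneg_right ((min_le_right _ _).trans (min_le_left _ _)) hx
  have m3 : κ * x ≤ (1 - 2 * D * (β / A)) * x :=
    mul_le_mul_of_nonneg_right ((min_le_right _ _).trans (min_le_right _ _)) hx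
  have hv1 : β * x ≤ v := by rw [hv]; exact Nat.le_ceil _
  have hv2 : (v : ℝ) < β * x + 1 := by rw [hv]; exact Nat.ceil_lt_add_one (by positivity)
  have hh2 : (h : ℝ) < β * x / A + 1 := by rw [hh]; exact Nat.ceil_lt_add_one (by positivity)
  have hh3 : A * h ≤ β * x + A := by
    have := mul_le_mul_of_nonneg_left hh2.le hA0.le
    rw [mul_add, mul_div_cancel₀ _ hA0.ne'] at this
    linarith
  have hh4 : β * x / A = β / A * x := by ring
  refine ⟨fun l hl => ?_, ?_, ?_⟩
  · have hl' : (l : ℝ) ≤ h := by exact_mod_cast hl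
    have hl0 : (0 : ℝ) ≤ l := Nat.cast_nonneg l
    have hAl : A * l ≤ A * h := mul_le_mul_of_nonneg_left hl' hA0.le
    have hsub : (v : ℝ) - k l ≤ ((v - k l : ℕ) : ℝ) := by
      rw [sub_le_iff_le_add]
      exact_mod_cast (show v ≤ v - k l + k l by omega)
    -- When the truncated ceiling `k l` is 0, this follows from Al ≤ Ah ≤ βx + A; otherwise the
    -- rounding loses at most 1 < A.
    have hkl : A * l - A ≤ (v : ℝ) - k l := by
      rcases le_or_gt (β * x - A * l) 0 with h1 | h1
      · have : k l = 0 := by rw [hk, Nat.ceil_eq_zero]; exact h1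
        rw [this]
        push_cast
        linarith
      · have : (k l : ℝ) < β * x - A * l + 1 := by
          rw [hk]; exact Nat.ceil_lt_add_one h1.le
        linarith
    have hDl : D * l ≤ A * l := mul_le_mul_of_nonneg_right (by linarith) hl0
    have hDv : D * v ≤ D * (β * x + 1) := mul_le_mul_of_nonneg_left hv2.le hD0.le
    nlinarith
  · have h1 : ((h - 1 : ℕ) : ℝ) = h - 1 := by
      rw [Nat.cast_sub h0]; simp
    have hDv : D * v ≤ D * (β * x + 1) := mul_le_mul_of_nonneg_left hv2.le hD0.le
    have hDh : (D - 1) * h ≤ (D - 1) * (β / A * x + 1) :=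
      mul_le_mul_of_nonneg_left (by linarith) (by linarith)
    rw [h1]
    nlinarith
  · have hDh : D * h ≤ D * (β / A * x + 1) := mul_le_mul_of_nonneg_left (by linarith) hD0.le
    nlinarith

theorem tendsto_pow_mul_exp_neg_rpow (m : ℕ) {c κ : ℝ} (hc : 0 < c) (hκ : 0 < κ) :
    Tendsto (fun n : ℕ => (n : ℝ) ^ m * Real.exp (-(c * (n : ℝ) ^ κ))) atTop (𝓝 0) := by
  have h1 := tendsto_rpow_mul_exp_neg_mul_atTop_nhds_zero (m / κ) c hc
  have h2 : Tendsto (fun n : ℕ => (n : ℝ) ^ κ) atTop atTop :=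
    (tendsto_rpow_atTop hκ).comp tendsto_natCast_atTop_atTop
  refine (h1.comp h2).congr fun n => ?_
  simp only [Function.comp]
  rw [← Real.rpow_mul (Nat.cast_nonneg n), mul_div_cancel₀ _ hκ.ne', Real.rpow_natCast, neg_mul]

theorem two_rpow_nodeDim {p : ℝ} (hp : 0 < p ∧ p < 1) :
    (1 - p) / 2 = 2 ^ (-(nodeDim p - 1)) := by
  have h1 : (0 : ℝ) < 1 - p := by linarith
  have h2 : (2 : ℝ) ^ nodeDim p = 4 / (1 - p) := by
    rw [nodeDim, ← Real.logb]
    exact Real.rpow_logb (by norm_num) (by norm_num) (by positivity)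
  rw [neg_sub, Real.rpow_sub (by norm_num), h2, Real.rpow_one]
  field_simp
  norm_num

theorem two_rpow_relayDim {pr : ℝ} (hpr : 0 < pr ∧ pr < 1) :
    (1 - pr) / 2 = 2 ^ (-(relayDim pr / 2)) := by
  have h1 : (0 : ℝ) < 1 - pr := by linarith
  have h2 : (2 : ℝ) ^ (relayDim pr / 2) = 2 / (1 - pr) := by
    rw [relayDim, mul_div_cancel_left₀ _ (by norm_num), ← Real.logb]
    exact Real.rpow_logb (by norm_num) (by norm_num) (by positivity)
  rw [Real.rpow_neg (by norm_num), h2, inv_div]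

theorem one_lt_relayDim_div_two {pr : ℝ} (hpr : 0 < pr ∧ pr < 1) : 1 < relayDim pr / 2 := by
  have h1 : (0 : ℝ) < 1 - pr := by linarith
  rw [relayDim, mul_div_cancel_left₀ _ (by norm_num), lt_div_iff₀ (Real.log_pos (by norm_num)),
    one_mul]
  apply Real.log_lt_log (by norm_num)
  rw [lt_div_iff₀ h1]
  linarith

theorem exists_typical_levels {p pr : ℝ} (hp : 0 < p ∧ p < 1) (hpr : 0 < pr ∧ pr < 1)
    (hdF : 3 < nodeDim p) (hdr : relayDim pr < nodeDim p - 1) :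
    ∃ (h v t : ℕ → ℕ) (k : ℕ → ℕ → ℕ),
      (∀ᶠ n in atTop, 0 < h n ∧ h n < v n ∧ (∀ l, h n ≤ l → k n l = 0) ∧
        9 * ((t n : ℝ) + 1) + 1 ≤ 55 * (n : ℝ) ^ hopExponent p pr) ∧
      Tendsto (fun n => hyperfractalLaw p pr n {ω | ¬ IsTypical ω (h n) (v n) (t n) (k n)})
        atTop (𝓝 0) := by
  set A := nodeDim p - 1 with hA
  set D := relayDim pr / 2 with hD
  set γ := hopExponent p pr with hγ
  have hA2 : 2 < A := by linarith
  have hD1 : 1 < D := one_lt_relayDim_div_two hpr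
  have hDA : 2 * D < A := by simp only [hD]; linarith
  have ha := two_rpow_nodeDim hp
  have hb := two_rpow_relayDim hpr
  rw [← hA] at ha
  rw [← hD] at hb
  set β := 1 - γ with hβ'
  have hβ : β = (A + 1) / (D * (A + 2)) := by
    have e1 : nodeDim p = A + 1 := by rw [hA]; ring
    have e2 : relayDim pr = 2 * D := by rw [hD]; ring
    rw [hβ', hγ, hopExponent, e1, e2]
    have : A + 1 ≠ 0 := by linarith
    have : A + 2 ≠ 0 := by linarith
    have : A + 1 + 1 ≠ 0 := by linarith
    have : D ≠ 0 := by linarith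
    field_simp
    ring
  have hβ0 : 0 < β := by rw [hβ]; exact div_pos (by linarith) (mul_pos (by linarith) (by linarith))
  have hβ1 : β < 1 := by
    rw [hβ, div_lt_one (mul_pos (by linarith) (by linarith))]
    nlinarith
  have hγ0 : 0 < γ := by linarith
  obtain ⟨κ, hκ, K, hK⟩ := exists_exponent hA2 hD1 hDA hβ
  set x : ℕ → ℝ := fun n => Real.logb 2 n with hx
  have hx2 : ∀ n : ℕ, 1 ≤ n → (2 : ℝ) ^ x n = n := fun n hn =>
    Real.rpow_logb (by norm_num) (by norm_num) (by exact_mod_cast hn)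
  have hx0 : ∀ n : ℕ, 1 ≤ n → 0 ≤ x n := fun n hn =>
    Real.logb_nonneg (by norm_num) (by exact_mod_cast hn)
  have hxt : Tendsto x atTop atTop :=
    (Real.tendsto_logb_atTop (by norm_num)).comp tendsto_natCast_atTop_atTop
  set h : ℕ → ℕ := fun n => ⌈β * x n / A⌉₊ with hh
  set v : ℕ → ℕ := fun n => ⌈β * x n⌉₊ with hv
  set k : ℕ → ℕ → ℕ := fun n l => ⌈β * x n - A * l⌉₊ with hk
  -- The factor 4 ensures 2^t ≥ exp(2n^γ), which beats the factor exp(n^γ) in the bound for crowded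
  -- cells, since exp 2 ≤ 2^4.
  set t : ℕ → ℕ := fun n => ⌈4 * (n : ℝ) ^ γ⌉₊ with ht
  have hA0 : 0 < A := by linarith
  have ev : ∀ᶠ n : ℕ in atTop, 1 ≤ n ∧ 2 ≤ β * x n :=
    (eventually_ge_atTop 1).and ((hxt.const_mul_atTop hβ0).eventually_ge_atTop 2)
  have hpow : ∀ n : ℕ, 1 ≤ n → ∀ z : ℝ, (2 : ℝ) ^ (z * x n) = (n : ℝ) ^ z := by
    intro n hn z
    rw [mul_comm, Real.rpow_mul (by norm_num), hx2 n hn]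
  have hone : ∀ n : ℕ, 1 ≤ n → (1 : ℝ) ≤ (n : ℝ) ^ γ := fun n hn =>
    Real.one_le_rpow (by exact_mod_cast hn) hγ0.le
  have hlev : ∀ n : ℕ, 1 ≤ n → 2 ≤ β * x n → 0 < h n ∧ h n < v n := by
    intro n hn h2
    refine ⟨Nat.ceil_pos.2 (by positivity), ?_⟩
    have h1 : (h n : ℝ) < β * x n / A + 1 := Nat.ceil_lt_add_one (by positivity)
    have h3 : β * x n ≤ v n := Nat.le_ceil _
    have h4 : β * x n / A ≤ β * x n / 2 := by gcongr
    have h5 : (h n : ℝ) < v n := by linarith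
    exact_mod_cast h5
  refine ⟨h, v, t, k, ?_, ?_⟩
  · filter_upwards [ev] with n hn
    obtain ⟨l1, l2⟩ := hlev n hn.1 hn.2
    refine ⟨l1, l2, fun l hl => ?_, ?_⟩
    · rw [hk, Nat.ceil_eq_zero]
      have h1 : β * x n / A ≤ h n := Nat.le_ceil _
      rw [div_le_iff₀ hA0] at h1
      have h2 : (h n : ℝ) ≤ l := by exact_mod_cast hl
      nlinarith
    · have h1 : (t n : ℝ) < 4 * (n : ℝ) ^ γ + 1 :=
        Nat.ceil_lt_add_one (by have := hone n hn.1; linarith)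
      -- With y = n^γ ≥ 1, 9(t + 1) + 1 ≤ 36y + 19 ≤ 55y.
      linarith [hone n hn.1]
  · set c : ℝ := pr ^ 2 * 2 ^ (-K) with hc
    have hc0 : 0 < c := by have := hpr.1; positivity
    -- The factor 2^(−A) absorbs the ceiling in `h n`, and 1/20 is 1/2 from the density times 1/10
    -- from the tenths of a street.
    set c' : ℝ := p / 20 * 2 ^ (-A) with hc'
    have hc0' : 0 < c' := by have := hp.1; positivity
    have lim : Tendsto (fun n : ℕ => ENNReal.ofReal
        (2 * ((n : ℝ) ^ 1 * Real.exp (-(1 * (n : ℝ) ^ γ))) +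
          80 * ((n : ℝ) ^ 1 * Real.exp (-(c' * (n : ℝ) ^ γ))) +
          64 * ((n : ℝ) ^ 2 * Real.exp (-(c * (n : ℝ) ^ κ))))) atTop (𝓝 0) := by
      rw [← ENNReal.ofReal_zero]
      apply ENNReal.tendsto_ofReal
      have := (((tendsto_pow_mul_exp_neg_rpow 1 one_pos hγ0).const_mul 2).add
        ((tendsto_pow_mul_exp_neg_rpow 1 hc0' hγ0).const_mul 80)).add
        ((tendsto_pow_mul_exp_neg_rpow 2 hc0 hκ).const_mul 64)
      simpa using this
    refine tendsto_of_tendsto_of_tendsto_of_le_of_le' tendsto_const_nhds lim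
      (Eventually.of_forall fun _ => zero_le) ?_
    filter_upwards [ev] with n hn
    obtain ⟨hn, hn2⟩ := hn
    obtain ⟨l1, l2⟩ := hlev n hn hn2
    obtain ⟨r1, r2, r3⟩ := hK (x n) (hx0 n hn) (h n) (v n) (k n) rfl rfl (fun _ => rfl) l1
    have hn0 : (0 : ℝ) < n := by exact_mod_cast hn
    have hmean : ∀ e m : ℕ, κ * x n - K ≤ (e : ℝ) + x n - D * m →
        c * (n : ℝ) ^ κ ≤ 2 ^ e * (n * pr ^ 2 * ((1 - pr) / 2) ^ m) := by
      intro e m hem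
      have h1 : (2 : ℝ) ^ e * (n * pr ^ 2 * ((1 - pr) / 2) ^ m) =
          pr ^ 2 * 2 ^ ((e : ℝ) + x n - D * m) := by
        rw [hb, ← Real.rpow_mul_natCast (by norm_num), ← Real.rpow_natCast 2 e,
          Real.rpow_sub (by norm_num), Real.rpow_add (by norm_num), hx2 n hn, neg_mul,
          Real.rpow_neg (by norm_num)]
        field_simp
      have h2 : c * (n : ℝ) ^ κ = pr ^ 2 * 2 ^ (κ * x n - K) := by
        rw [hc, sub_eq_add_neg, Real.rpow_add (by norm_num), hpow n hn]
        ring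
      rw [h1, h2]
      gcongr
      norm_num
    have hdens : ∀ l : ℕ, n * ((1 - p) / 2) ^ l = 2 ^ (x n - A * l) := by
      intro l
      rw [ha, ← Real.rpow_mul_natCast (by norm_num), Real.rpow_sub (by norm_num),
        hx2 n hn, neg_mul, Real.rpow_neg (by norm_num)]
      rfl
    have hγx : γ * x n = x n - β * x n := by rw [hβ']; ring
    have hbound := hyperfractalLaw_not_isTypical_le (pr := pr) hp n (t := t n) (k := k n)
      (B := (n : ℝ) ^ γ) (r := c * (n : ℝ) ^ κ) l1 l2.le
      (fun l _ => Nat.ceil_mono (by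
        have : 0 ≤ A * l := by positivity
        linarith))
      (Nat.one_le_ceil_iff.2 (by have := hone n hn; linarith))
      (fun l => by
        rw [← mul_div_assoc, hdens, div_le_iff₀ (by positivity), ← hpow n hn, ← Real.rpow_natCast,
          ← Real.rpow_add (by norm_num)]
        apply Real.rpow_le_rpow_of_exponent_le (by norm_num)
        have : β * x n - A * l ≤ k n l := Nat.le_ceil _
        linarith)
      (fun l hl => hmean _ _ (by push_cast; exact r1 l hl))
      (hmean _ _ (by push_cast; exact r2))
      (by
        have := hmean 0 (h n + h n) (by push_cast; linarith)
        simpa using this)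
    refine hbound.trans ?_
    -- Since β < 1, the number of streets in the union bounds is polynomial in n, so the
    -- exponentially small probabilities win.
    have hvn : (2 : ℝ) ^ v n ≤ 2 * n := by
      have h1 : (v n : ℝ) < β * x n + 1 := Nat.ceil_lt_add_one (by linarith)
      have h2 : (v n : ℝ) ≤ x n + 1 := by nlinarith [hx0 n hn]
      rw [← Real.rpow_natCast]
      refine (Real.rpow_le_rpow_of_exponent_le (by norm_num) h2).trans (le_of_eq ?_)
      rw [Real.rpow_add (by norm_num), hx2 n hn, Real.rpow_one, mul_comm]
    have hvn4 : (4 : ℝ) ^ v n ≤ 4 * n ^ 2 := by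
      calc (4 : ℝ) ^ v n = (2 ^ v n) ^ 2 := by rw [← pow_mul, mul_comm, pow_mul]; norm_num
        _ ≤ (2 * n) ^ 2 := by gcongr
        _ = 4 * n ^ 2 := by ring
    have t1 : n * Real.exp ((n : ℝ) ^ γ) / (2 ^ t n - 1) ≤
        2 * ((n : ℝ) ^ 1 * Real.exp (-(1 * (n : ℝ) ^ γ))) := by
      set y := (n : ℝ) ^ γ with hy
      have hy1 : 1 ≤ y := hone n hn
      have h1 : Real.exp (2 * y) ≤ 2 ^ t n := by
        have h2 : Real.exp 2 ≤ 2 ^ (4 : ℝ) := by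
          have := Real.exp_one_lt_d9
          have e2 : Real.exp 2 = Real.exp 1 ^ 2 := by rw [← Real.exp_nat_mul]; norm_num
          rw [e2]
          calc Real.exp 1 ^ 2 ≤ 3 ^ 2 := by gcongr; linarith
            _ ≤ 2 ^ (4 : ℝ) := by norm_num
        calc Real.exp (2 * y) = Real.exp 2 ^ y := by rw [Real.exp_mul]
          _ ≤ (2 ^ (4 : ℝ)) ^ y := Real.rpow_le_rpow (Real.exp_pos _).le h2 (by linarith)
          _ = 2 ^ (4 * y) := by rw [← Real.rpow_mul (by norm_num)]
          _ ≤ 2 ^ (t n : ℝ) := Real.rpow_le_rpow_of_exponent_le (by norm_num) (Nat.le_ceil _)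
          _ = 2 ^ t n := Real.rpow_natCast _ _
      have h3 : 2 ≤ Real.exp (2 * y) := by linarith [Real.add_one_le_exp (2 * y)]
      have h4 : Real.exp (2 * y) / 2 ≤ 2 ^ t n - 1 := by linarith
      calc n * Real.exp y / (2 ^ t n - 1) ≤ n * Real.exp y / (Real.exp (2 * y) / 2) := by
            gcongr
        _ = 2 * ((n : ℝ) ^ 1 * Real.exp (-(1 * y))) := by
            rw [one_mul, pow_one, two_mul, Real.exp_add, Real.exp_neg]
            field_simp
    have t2 : (40 * 2 ^ v n : ℝ) * Real.exp (-(n * (p / 2 * ((1 - p) / 2) ^ h n) / 10)) ≤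
        80 * ((n : ℝ) ^ 1 * Real.exp (-(c' * (n : ℝ) ^ γ))) := by
      have h1 : c' * (n : ℝ) ^ γ ≤ n * (p / 2 * ((1 - p) / 2) ^ h n) / 10 := by
        have e1 : n * (p / 2 * ((1 - p) / 2) ^ h n) / 10 = p / 20 * 2 ^ (x n - A * h n) := by
          rw [← hdens]; ring
        have e2 : c' * (n : ℝ) ^ γ = p / 20 * 2 ^ (γ * x n - A) := by
          rw [hc', sub_eq_add_neg, Real.rpow_add (by norm_num), hpow n hn]; ring
        rw [e1, e2]
        refine mul_le_mul_of_nonneg_left (Real.rpow_le_rpow_of_exponent_le (by norm_num) ?_)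
          (by linarith [hp.1])
        have h1 : (h n : ℝ) < β * x n / A + 1 := Nat.ceil_lt_add_one (by positivity)
        have h2 := mul_le_mul_of_nonneg_left h1.le hA0.le
        rw [mul_add, mul_div_cancel₀ _ hA0.ne'] at h2
        linarith
      calc (40 * 2 ^ v n : ℝ) * Real.exp (-(n * (p / 2 * ((1 - p) / 2) ^ h n) / 10))
          ≤ (40 * (2 * n)) * Real.exp (-(c' * (n : ℝ) ^ γ)) := by gcongr
        _ = _ := by ring
    have t3 : (16 * 4 ^ v n : ℝ) * Real.exp (-(c * (n : ℝ) ^ κ)) ≤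
        64 * ((n : ℝ) ^ 2 * Real.exp (-(c * (n : ℝ) ^ κ))) := by
      calc (16 * 4 ^ v n : ℝ) * Real.exp (-(c * (n : ℝ) ^ κ))
          ≤ (16 * (4 * n ^ 2)) * Real.exp (-(c * (n : ℝ) ^ κ)) := by gcongr
        _ = _ := by ring
    rw [ENNReal.ofReal_add (by positivity) (by positivity),
      ENNReal.ofReal_add (by positivity) (by positivity)]
    refine add_le_add (add_le_add (ENNReal.ofReal_le_ofReal t1) ?_) ?_
    · rw [← ENNReal.ofReal_natCast, ← ENNReal.ofReal_mul (by positivity)]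
      apply ENNReal.ofReal_le_ofReal
      push_cast
      exact t2
    · rw [← ENNReal.ofReal_natCast, ← ENNReal.ofReal_mul (by positivity)]
      apply ENNReal.ofReal_le_ofReal
      push_cast
      exact t3

end Hyperfractal

end

/-! ### The theorem -/

theorem mainTheorem4 (p pr δ Pmax vE : ℝ)
    (hp : 0 < p ∧ p < 1) (hpr : 0 < pr ∧ pr < 1)
    (hdF : 3 < Hyperfractal.nodeDim p)
    (hdr : Hyperfractal.relayDim pr < Hyperfractal.nodeDim p - 1)
    (hδ : 2 ≤ δ) (hPmax : 0 < Pmax) (hvE : 6 < vE) :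
    (∃ C : ℝ, 0 < C ∧
      Tendsto (fun n : ℕ => Hyperfractal.hyperfractalLaw p pr n
        {ω | ∃ i ∈ Hyperfractal.giant Pmax δ ω 1 (vE * Pmax),
          ∃ j ∈ Hyperfractal.giant Pmax δ ω 1 (vE * Pmax),
            ENNReal.ofReal (C * (n : ℝ) ^ Hyperfractal.hopExponent p pr) <
              Hyperfractal.shortestLength Pmax δ ω (vE * Pmax) i j})
        atTop (𝓝 0)) ∧
    (∀ ε : ℝ, 0 < ε → ∃ C : ℝ, 0 < C ∧
      ∀ᶠ n : ℕ in atTop, ∀ i j : Fin n, i ≠ j →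
        Hyperfractal.hyperfractalLaw p pr n
          {ω | (∃ s s' : Hyperfractal.Street, s.level = 0 ∧ s'.level = 0 ∧ s ≠ s' ∧
              ω.1 i ∈ s.carrier ∧ ω.1 j ∈ s'.carrier) ∧
            ¬ ∃ T : List (Hyperfractal.Node n × Hyperfractal.Street),
              Hyperfractal.IsRouteBetween Pmax δ ω (vE * Pmax) i j T ∧
              (T.map Prod.fst).Nodup ∧ Hyperfractal.relayCount T = 5 ∧
              (T.length : ℝ) ≤ C * (n : ℝ) ^ Hyperfractal.hopExponent p pr}
          ≤ ENNReal.ofReal ε) := by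
  obtain ⟨h, v, t, k, hev, hlim⟩ := Hyperfractal.exists_typical_levels hp hpr hdF hdr
  have hE : 6 * Pmax ≤ vE * Pmax := mul_le_mul_of_nonneg_right hvE.le hPmax.le
  -- Both failure events lie in the complement of the typical configurations, so C = 55 serves both
  -- statements and does not depend on ε.
  refine ⟨⟨55, by norm_num, ?_⟩, fun ε hε => ⟨55, by norm_num, ?_⟩⟩
  · refine tendsto_of_tendsto_of_tendsto_of_le_of_le' tendsto_const_nhds hlim
      (Eventually.of_forall fun _ => zero_le) ?_
    filter_upwards [hev] with n hn
    obtain ⟨-, hv, hk, hlen⟩ := hn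
    refine measure_mono ?_
    rintro ω ⟨i, hi, j, hj, hlt⟩ G
    obtain ⟨T, ⟨hT, hTi, hTj, hTE⟩, hTl⟩ :=
      Hyperfractal.IsTypical.exists_route_of_mem_giant hPmax hδ G hk hv.le hi hj
    -- One route bounds the infimum; this also rules out the value ∞, so a shortest path exists.
    refine absurd hlt (not_lt.2 ?_)
    refine (iInf₂_le T (show Hyperfractal.IsRouteBetween Pmax δ ω (vE * Pmax) i j T from
      ⟨hT, hTi, hTj, hTE.trans hE⟩)).trans ?_
    rw [← ENNReal.ofReal_natCast]
    exact ENNReal.ofReal_le_ofReal (hTl.trans hlen)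
  · filter_upwards [hev, hlim.eventually_le_const (ENNReal.ofReal_pos.2 hε)] with n hn hle i j _
    obtain ⟨h0, hv, hk, hlen⟩ := hn
    refine (measure_mono ?_).trans hle
    rintro ω ⟨⟨s, s', hs, hs', hne, hi, hj⟩, hno⟩ G
    apply hno
    obtain ⟨d, A, rfl⟩ := s.exists_ofDir
    obtain ⟨d', B, rfl⟩ := s'.exists_ofDir
    rw [Hyperfractal.Street.level_ofDir] at hs hs'
    have hd : d' = !d := by
      have : d ≠ d' := fun e => hne (by rw [e, Hyperfractal.Line.eq_of_level_zero hs hs'])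
      cases d <;> cases d' <;> simp_all
    subst hd
    obtain ⟨T, ⟨hT, hTi, hTj, hTE⟩, hnd, h5, hTl⟩ :=
      Hyperfractal.IsTypical.exists_route_of_cross hPmax hδ G hk h0 hv hs hs' hi hj
    exact ⟨T, ⟨hT, hTi, hTj, hTE.trans hE⟩, hnd, h5, hTl.trans hlen⟩
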